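/- Let $\mathcal G$ be a metric graph with finitely many vertices and finitely many edges. Each edge $e$ has a length $L_e\in(0,\infty]$ and is identified with $I_e=[0,L_e]$ if $L_e<\infty$, both endpoints being attached to vertices, and with $I_e=[0,\infty)$ if $L_e=\infty$, the endpoint $0$ being attached to a vertex. Assume that at least one edge has infinite length. Put $L^2(\mathcal G)=\bigoplus_e L^2(I_e;\mathbb C)$ and $H^2(\mathcal G)=\bigoplus_e H^2(I_e;\mathbb C)$. For a vertex $v$ let $d_v$ be the number of edge ends attached to $v$. For $\psi\in H^2(\mathcal G)$ let $\Psi(v)\in\mathbb C^{d_v}$ be the vector of the values of $\psi$ at these ends, and $\Psi'(v)\in\mathbb C^{d_v}$ the vector of the derivatives of $\psi$ at these ends, taken in the directions from $v$ into the edges. For every vertex $v$ let $A_v,B_v$ be complex $d_v\times d_v$ matrices, and let $\operatorname H$ be the operator in $L^2(\mathcal G)$ given by $\operatorname H\psi=(-\psi_e'')_e$ on the domain $$D(\operatorname H)=\{\psi\in H^2(\mathcal G): A_v\Psi(v)+B_v\Psi'(v)=0\ \text{for every vertex } v\}.$$ If $\operatorname H$ is self-adjoint, then its essential spectrum is $$\sigma_{ess}(\operatorname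 H)=[0,\infty).$$ Here $\sigma_{ess}(\operatorname H)=\sigma(\operatorname H)\setminus\sigma_{disc}(\operatorname H)$, where $\sigma_{disc}(\operatorname H)$ is the set of isolated points of the spectrum $\sigma(\operatorname H)$ that are eigenvalues of finite multiplicity. -/

import Mathlib

open MeasureTheory
open scoped ENNReal ContDiff Matrix

noncomputable section

/-! ### Spectrum of an unbounded operator -/

namespace UnboundedOperator

variable {X : Type*} [NormedAddCommGroup X] [InnerProductSpace ℂ X]

/-- The resolvent set: all `z` such that `T - z` is a bijection of the domain of `T` onto the whole
space, with a bounded inverse `R`. -/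
def resolventSet (T : X →ₗ.[ℂ] X) : Set ℂ :=
  {z | ∃ R : X →L[ℂ] X,
    (∀ f : X, ∃ h : R f ∈ T.domain, T ⟨R f, h⟩ - z • R f = f) ∧
    ∀ u : T.domain, R (T u - z • (u : X)) = u}

/-- The spectrum, the complement of the resolvent set. -/
def spectrum (T : X →ₗ.[ℂ] X) : Set ℂ := (resolventSet T)ᶜ

/-- The eigenspace `ker (T - z)`, as a subspace of the domain of `T`. -/
def eigenspace (T : X →ₗ.[ℂ] X) (z : ℂ) : Submodule ℂ T.domain :=
  LinearMap.ker (T.toFun - z • T.domain.subtype)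

/-- The discrete spectrum of a self-adjoint operator: the isolated points of the spectrum which are
eigenvalues of finite multiplicity. -/
def discreteSpectrum (T : X →ₗ.[ℂ] X) : Set ℂ :=
  {z | z ∈ spectrum T ∧ (∃ ε > 0, ∀ w ∈ spectrum T, dist w z < ε → w = z) ∧
    eigenspace T z ≠ ⊥ ∧ FiniteDimensional ℂ (eigenspace T z)}

/-- The essential spectrum of a self-adjoint operator: the spectrum without the discrete
spectrum. -/
def essentialSpectrum (T : X →ₗ.[ℂ] X) : Set ℂ := spectrum T \ discreteSpectrum T

end UnboundedOperator

/-! ### Metric graphs -/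

/-- A metric graph with vertex set `V` and edge set `E`. Each edge has a length in `(0, ∞]`. An edge
`e` of finite length is identified with `[0, length e]`, where `0` is attached to the vertex
`origin e` and `length e` to the vertex `terminus e`; an edge of infinite length is identified with
`[0, ∞)`, where `0` is attached to the vertex `origin e`. Loops and multiple edges are allowed. -/
structure MetricGraph (V E : Type*) where
  /-- The length of an edge. -/
  length : E → ℝ≥0∞
  length_pos : ∀ e, 0 < length e
  /-- The vertex at coordinate `0`. -/
  origin : E → V
  /-- The vertex at the other endpoint of an edge of finite length. -/
  terminus : {e : E // length e ≠ ⊤} → V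

namespace MetricGraph

variable {V E : Type*} (G : MetricGraph V E)

/-- The interval `I_e`, that is `[0, length e]` or `[0, ∞)`. -/
def closedEdge (e : E) : Set ℝ := {x | 0 ≤ x ∧ ENNReal.ofReal x ≤ G.length e}

/-- The interior of `I_e`, that is `(0, length e)` or `(0, ∞)`. -/
def openEdge (e : E) : Set ℝ := {x | 0 < x ∧ ENNReal.ofReal x < G.length e}

/-- Lebesgue measure on an edge (the endpoints are a null set). -/
def edgeMeasure (e : E) : Measure ℝ := volume.restrict (G.openEdge e)

/-- The Hilbert space `L²(I_e)` of complex-valued functions on one edge. -/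
abbrev EdgeL2 (e : E) : Type := Lp ℂ 2 (G.edgeMeasure e)

/-- The Hilbert space `L²(G) = ⨁ₑ L²(I_e)`. -/
abbrev L2 : Type _ := PiLp 2 (fun e : E => G.EdgeL2 e)

/-- The ends of the edges: the initial end of every edge and the terminal end of every edge of
finite length. -/
abbrev EdgeEnd : Type _ := E ⊕ {e : E // G.length e ≠ ⊤}

/-- The vertex to which an end is attached. -/
def endVertex : G.EdgeEnd → V := Sum.elim G.origin G.terminus

/-- The edge to which an end belongs. -/
def endEdge : G.EdgeEnd → E := Sum.elim id Subtype.val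

/-- The coordinate of an end on its edge. -/
def endCoord : G.EdgeEnd → ℝ := Sum.elim (fun _ => 0) (fun e => (G.length e).toReal)

/-- The sign which turns the derivative in the coordinate of the edge into the derivative in the
direction from the vertex into the edge. -/
def endSign : G.EdgeEnd → ℂ := Sum.elim (fun _ => 1) (fun _ => -1)

/-- The ends attached to the vertex `v`; their number is the degree `d_v`. -/
abbrev EndsAt (v : V) : Type _ := {a : G.EdgeEnd // G.endVertex a = v}

instance instFintypeEndsAt [Fintype E] (v : V) : Fintype (G.EndsAt v) := Fintype.ofFinite _

/-- The vector `Ψ(v)` of the values at the ends attached to `v`. -/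
def vertexValues (F : E → ℝ → ℂ) (v : V) : G.EndsAt v → ℂ :=
  fun a => F (G.endEdge a) (G.endCoord a)

/-- The vector `Ψ'(v)` of the derivatives at the ends attached to `v`, taken in the directions from
`v` into the edges, where `F'` is the derivative in the coordinates of the edges. -/
def vertexDerivs (F' : E → ℝ → ℂ) (v : V) : G.EndsAt v → ℂ :=
  fun a => G.endSign a * F' (G.endEdge a) (G.endCoord a)

/-- `g` is the weak derivative of `f` on the edge `e`. -/
def HasEdgeWeakDeriv (e : E) (f g : G.EdgeL2 e) : Prop :=
  ∀ φ : ℝ → ℝ, ContDiff ℝ ∞ φ → HasCompactSupport φ → tsupport φ ⊆ G.openEdge e →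
    ∫ x, deriv φ x • f x ∂G.edgeMeasure e = - ∫ x, φ x • g x ∂G.edgeMeasure e

/-- `χ` is the weak derivative of `ψ` on every edge. In particular `ψ` is in `H¹(G)`. -/
def HasWeakDeriv (ψ χ : G.L2) : Prop := ∀ e, G.HasEdgeWeakDeriv e (ψ e) (χ e)

/-- The functions `F e` are the representatives of the `ψ e` that are continuous up to the
endpoints. -/
def IsContinuousRep (ψ : G.L2) (F : E → ℝ → ℂ) : Prop :=
  ∀ e, ContinuousOn (F e) (G.closedEdge e) ∧ ψ e =ᵐ[G.edgeMeasure e] F e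

/-- The vertex conditions `A_v Ψ(v) + B_v Ψ'(v) = 0` for all `v`, for a function `ψ` with weak
derivative `χ`, both evaluated through their continuous representatives. -/
def VertexConditions [Fintype E] (A B : ∀ v, Matrix (G.EndsAt v) (G.EndsAt v) ℂ)
    (ψ χ : G.L2) : Prop :=
  ∃ F F' : E → ℝ → ℂ, G.IsContinuousRep ψ F ∧ G.IsContinuousRep χ F' ∧
    ∀ v, A v *ᵥ G.vertexValues F v + B v *ᵥ G.vertexDerivs F' v = 0

variable {G}

lemma isOpen_openEdge (e : E) : IsOpen (G.openEdge e) :=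
  (isOpen_lt continuous_const continuous_id).inter
    (isOpen_lt ENNReal.continuous_ofReal continuous_const)

lemma integrable_smul_edge {e : E} (f : G.EdgeL2 e) {φ : ℝ → ℝ} (hφ : Continuous φ)
    (hc : HasCompactSupport φ) : Integrable (fun x => φ x • f x) (G.edgeMeasure e) := by
  have : IsLocallyFiniteMeasure (G.edgeMeasure e) := by unfold edgeMeasure; infer_instance
  exact ((Lp.memLp f).locallyIntegrable (by norm_num)).integrable_smul_left_of_hasCompactSupport
    hφ hc

lemma HasEdgeWeakDeriv.add {e : E} {f₁ g₁ f₂ g₂ : G.EdgeL2 e} (h₁ : G.HasEdgeWeakDeriv e f₁ g₁)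
    (h₂ : G.HasEdgeWeakDeriv e f₂ g₂) : G.HasEdgeWeakDeriv e (f₁ + f₂) (g₁ + g₂) := by
  intro φ hφ hc hs
  have hd : Continuous (deriv φ) := hφ.continuous_deriv (by simp)
  have e₁ : ∫ x, deriv φ x • (f₁ + f₂ : G.EdgeL2 e) x ∂G.edgeMeasure e =
      ∫ x, (deriv φ x • f₁ x + deriv φ x • f₂ x) ∂G.edgeMeasure e := by
    refine integral_congr_ae ?_
    filter_upwards [Lp.coeFn_add f₁ f₂] with x hx
    rw [hx, Pi.add_apply, smul_add]
  have e₂ : ∫ x, φ x • (g₁ + g₂ : G.EdgeL2 e) x ∂G.edgeMeasure e =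
      ∫ x, (φ x • g₁ x + φ x • g₂ x) ∂G.edgeMeasure e := by
    refine integral_congr_ae ?_
    filter_upwards [Lp.coeFn_add g₁ g₂] with x hx
    rw [hx, Pi.add_apply, smul_add]
  rw [e₁, e₂, integral_add (integrable_smul_edge _ hd hc.deriv)
    (integrable_smul_edge _ hd hc.deriv), integral_add (integrable_smul_edge _ hφ.continuous hc)
    (integrable_smul_edge _ hφ.continuous hc), h₁ φ hφ hc hs, h₂ φ hφ hc hs, neg_add]

lemma HasEdgeWeakDeriv.smul {e : E} {f g : G.EdgeL2 e} (h : G.HasEdgeWeakDeriv e f g) (c : ℂ) :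
    G.HasEdgeWeakDeriv e (c • f) (c • g) := by
  intro φ hφ hc hs
  have key : ∀ (θ : ℝ → ℝ) (u : G.EdgeL2 e),
      ∫ x, θ x • (c • u : G.EdgeL2 e) x ∂G.edgeMeasure e =
        c • ∫ x, θ x • u x ∂G.edgeMeasure e := by
    intro θ u
    rw [← integral_smul]
    refine integral_congr_ae ?_
    filter_upwards [Lp.coeFn_smul c u] with x hx
    rw [hx, Pi.smul_apply, smul_comm]
  rw [key, key, h φ hφ hc hs, smul_neg]

lemma HasEdgeWeakDeriv.unique {e : E} {f g₁ g₂ : G.EdgeL2 e} (h₁ : G.HasEdgeWeakDeriv e f g₁)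
    (h₂ : G.HasEdgeWeakDeriv e f g₂) : g₁ = g₂ := by
  have : IsLocallyFiniteMeasure (G.edgeMeasure e) := by unfold edgeMeasure; infer_instance
  have hd : G.HasEdgeWeakDeriv e (f + (-1 : ℂ) • f) (g₁ + (-1 : ℂ) • g₂) := h₁.add (h₂.smul _)
  have hz : f + (-1 : ℂ) • f = 0 := by simp
  rw [hz] at hd
  have hae := (isOpen_openEdge (G := G) e).ae_eq_zero_of_integral_contDiff_smul_eq_zero
    (f := (g₁ + (-1 : ℂ) • g₂ : G.EdgeL2 e)) (μ := G.edgeMeasure e)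
    (((Lp.memLp _).locallyIntegrable (by norm_num)).locallyIntegrableOn _) (by
      intro φ hφ hc hs
      have h0 : ∫ x, deriv φ x • (0 : G.EdgeL2 e) x ∂G.edgeMeasure e = 0 := by
        rw [← integral_zero ℝ ℂ (μ := G.edgeMeasure e)]
        refine integral_congr_ae ?_
        filter_upwards [Lp.coeFn_zero ℂ 2 (G.edgeMeasure e)] with x hx
        rw [hx]; simp
      have := hd φ hφ hc hs
      rw [h0] at this
      exact neg_eq_zero.mp this.symm)
  have hmem : ∀ᵐ x ∂G.edgeMeasure e, x ∈ G.openEdge e :=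
    ae_restrict_mem (isOpen_openEdge e).measurableSet
  have : g₁ + (-1 : ℂ) • g₂ = 0 := by
    apply (Lp.eq_zero_iff_ae_eq_zero).mpr
    filter_upwards [hae, hmem] with x hx hm using hx hm
  rw [neg_one_smul, ← sub_eq_add_neg] at this
  exact sub_eq_zero.mp this

lemma HasWeakDeriv.add {ψ₁ χ₁ ψ₂ χ₂ : G.L2} (h₁ : G.HasWeakDeriv ψ₁ χ₁)
    (h₂ : G.HasWeakDeriv ψ₂ χ₂) : G.HasWeakDeriv (ψ₁ + ψ₂) (χ₁ + χ₂) :=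
  fun e => (h₁ e).add (h₂ e)

lemma HasWeakDeriv.smul {ψ χ : G.L2} (h : G.HasWeakDeriv ψ χ) (c : ℂ) :
    G.HasWeakDeriv (c • ψ) (c • χ) :=
  fun e => (h e).smul c

lemma HasWeakDeriv.zero : G.HasWeakDeriv (0 : G.L2) 0 := by
  intro e φ _ _ _
  have key : ∀ θ : ℝ → ℝ, ∫ x, θ x • (0 : G.EdgeL2 e) x ∂G.edgeMeasure e = 0 := by
    intro θ
    rw [← integral_zero ℝ ℂ (μ := G.edgeMeasure e)]
    refine integral_congr_ae ?_
    filter_upwards [Lp.coeFn_zero ℂ 2 (G.edgeMeasure e)] with x hx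
    rw [hx]; simp
  exact (key _).trans (by rw [PiLp.zero_apply, key, neg_zero])

lemma HasWeakDeriv.unique {ψ χ₁ χ₂ : G.L2} (h₁ : G.HasWeakDeriv ψ χ₁)
    (h₂ : G.HasWeakDeriv ψ χ₂) : χ₁ = χ₂ := by
  ext1 e
  exact (h₁ e).unique (h₂ e)

lemma IsContinuousRep.add {ψ₁ ψ₂ : G.L2} {F₁ F₂ : E → ℝ → ℂ} (h₁ : G.IsContinuousRep ψ₁ F₁)
    (h₂ : G.IsContinuousRep ψ₂ F₂) : G.IsContinuousRep (ψ₁ + ψ₂) (F₁ + F₂) :=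
  fun e => ⟨(h₁ e).1.add (h₂ e).1, (Lp.coeFn_add (ψ₁ e) (ψ₂ e)).trans ((h₁ e).2.add (h₂ e).2)⟩

lemma IsContinuousRep.smul {ψ : G.L2} {F : E → ℝ → ℂ} (h : G.IsContinuousRep ψ F) (c : ℂ) :
    G.IsContinuousRep (c • ψ) (c • F) :=
  fun e => ⟨(h e).1.const_smul c, (Lp.coeFn_smul c (ψ e)).trans ((h e).2.const_smul c)⟩

section Hamiltonian

variable [Fintype E] {A B : ∀ v, Matrix (G.EndsAt v) (G.EndsAt v) ℂ}

lemma VertexConditions.add {ψ₁ χ₁ ψ₂ χ₂ : G.L2} (h₁ : G.VertexConditions A B ψ₁ χ₁)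
    (h₂ : G.VertexConditions A B ψ₂ χ₂) : G.VertexConditions A B (ψ₁ + ψ₂) (χ₁ + χ₂) := by
  obtain ⟨F₁, F₁', hF₁, hF₁', hv₁⟩ := h₁
  obtain ⟨F₂, F₂', hF₂, hF₂', hv₂⟩ := h₂
  refine ⟨F₁ + F₂, F₁' + F₂', hF₁.add hF₂, hF₁'.add hF₂', fun v => ?_⟩
  have e₁ : G.vertexValues (F₁ + F₂) v = G.vertexValues F₁ v + G.vertexValues F₂ v := rfl
  have e₂ : G.vertexDerivs (F₁' + F₂') v = G.vertexDerivs F₁' v + G.vertexDerivs F₂' v := by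
    ext a; simp [vertexDerivs, mul_add]
  rw [e₁, e₂, Matrix.mulVec_add, Matrix.mulVec_add, add_add_add_comm, hv₁ v, hv₂ v, add_zero]

lemma VertexConditions.smul {ψ χ : G.L2} (h : G.VertexConditions A B ψ χ) (c : ℂ) :
    G.VertexConditions A B (c • ψ) (c • χ) := by
  obtain ⟨F, F', hF, hF', hv⟩ := h
  refine ⟨c • F, c • F', hF.smul c, hF'.smul c, fun v => ?_⟩
  have e₁ : G.vertexValues (c • F) v = c • G.vertexValues F v := rfl
  have e₂ : G.vertexDerivs (c • F') v = c • G.vertexDerivs F' v := by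
    ext a; simp [vertexDerivs, mul_left_comm]
  rw [e₁, e₂, Matrix.mulVec_smul, Matrix.mulVec_smul, ← smul_add, hv v, smul_zero]

lemma VertexConditions.zero : G.VertexConditions A B (0 : G.L2) 0 := by
  refine ⟨0, 0, fun e => ⟨continuousOn_const, Lp.coeFn_zero _ _ _⟩,
    fun e => ⟨continuousOn_const, Lp.coeFn_zero _ _ _⟩, fun v => ?_⟩
  have e₁ : G.vertexValues 0 v = 0 := rfl
  have e₂ : G.vertexDerivs 0 v = 0 := by ext a; simp [vertexDerivs]
  rw [e₁, e₂, Matrix.mulVec_zero, Matrix.mulVec_zero, add_zero]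

variable (G A B)

/-- The domain of the Hamiltonian: all `ψ ∈ H²(G)`, with weak derivatives `ψ₁ = ψ'` and `ψ₂ = ψ''`
in `L²(G)`, which satisfy the vertex conditions. -/
def hamiltonianDomain : Submodule ℂ G.L2 where
  carrier := {ψ | ∃ ψ₁ ψ₂ : G.L2, G.HasWeakDeriv ψ ψ₁ ∧ G.HasWeakDeriv ψ₁ ψ₂ ∧
    G.VertexConditions A B ψ ψ₁}
  zero_mem' := ⟨0, 0, HasWeakDeriv.zero, HasWeakDeriv.zero, VertexConditions.zero⟩
  add_mem' := by
    rintro ψ φ ⟨ψ₁, ψ₂, h₁, h₂, h₃⟩ ⟨φ₁, φ₂, k₁, k₂, k₃⟩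
    exact ⟨ψ₁ + φ₁, ψ₂ + φ₂, h₁.add k₁, h₂.add k₂, h₃.add k₃⟩
  smul_mem' := by
    rintro c ψ ⟨ψ₁, ψ₂, h₁, h₂, h₃⟩
    exact ⟨c • ψ₁, c • ψ₂, h₁.smul c, h₂.smul c, h₃.smul c⟩

variable {G A B}

lemma exists_secondDeriv (ψ : G.hamiltonianDomain A B) :
    ∃ ψ₂ : G.L2, ∃ ψ₁ : G.L2, G.HasWeakDeriv (ψ : G.L2) ψ₁ ∧ G.HasWeakDeriv ψ₁ ψ₂ := by
  obtain ⟨ψ₁, ψ₂, h₁, h₂, -⟩ := ψ.2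
  exact ⟨ψ₂, ψ₁, h₁, h₂⟩

/-- The weak second derivative `ψ''` of a function in the domain of the Hamiltonian. -/
def secondDeriv (ψ : G.hamiltonianDomain A B) : G.L2 := (exists_secondDeriv ψ).choose

lemma secondDeriv_eq {ψ : G.hamiltonianDomain A B} {ψ₁ ψ₂ : G.L2}
    (h₁ : G.HasWeakDeriv (ψ : G.L2) ψ₁) (h₂ : G.HasWeakDeriv ψ₁ ψ₂) : secondDeriv ψ = ψ₂ := by
  obtain ⟨χ, k₁, k₂⟩ := (exists_secondDeriv ψ).choose_spec
  obtain rfl := h₁.unique k₁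
  exact k₂.unique h₂

variable (G A B)

/-- The Hamiltonian `H ψ = (-ψ_e'')_e` on `L²(G)` with vertex conditions
`A_v Ψ(v) + B_v Ψ'(v) = 0`. -/
def hamiltonian : G.L2 →ₗ.[ℂ] G.L2 where
  domain := G.hamiltonianDomain A B
  toFun :=
    { toFun := fun ψ => -secondDeriv ψ
      map_add' := by
        intro ψ φ
        obtain ⟨ψ₁, h₁, h₂⟩ := (exists_secondDeriv ψ).choose_spec
        obtain ⟨φ₁, k₁, k₂⟩ := (exists_secondDeriv φ).choose_spec
        rw [secondDeriv_eq (ψ := ψ + φ) (h₁.add k₁) (h₂.add k₂), neg_add]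
        rfl
      map_smul' := by
        intro c ψ
        obtain ⟨ψ₁, h₁, h₂⟩ := (exists_secondDeriv ψ).choose_spec
        rw [secondDeriv_eq (ψ := c • ψ) (h₁.smul c) (h₂.smul c), RingHom.id_apply, smul_neg]
        rfl }

variable {G A B}

lemma hamiltonian_apply {ψ : (G.hamiltonian A B).domain} {ψ₁ ψ₂ : G.L2}
    (h₁ : G.HasWeakDeriv (ψ : G.L2) ψ₁) (h₂ : G.HasWeakDeriv ψ₁ ψ₂) :
    G.hamiltonian A B ψ = -ψ₂ :=
  congrArg Neg.neg (secondDeriv_eq (ψ := ψ) h₁ h₂)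

end Hamiltonian

end MetricGraph

end

/-! Nonreal points are in the resolvent set, so only real `t` matter.

For `t < 0`, integration by parts on each edge gives `Re ⟨ψ, Hψ⟩ = ‖ψ'‖² ≥ 0` as soon as `ψ`
vanishes at all edge ends, whatever the vertex conditions are (`re_inner_hamiltonian_nonneg`). There
are finitely many ends, so `H - t` is bounded below by `-t` on a subspace of finite codimension in
the domain. A self-adjoint operator with this property has `t` either in its resolvent set or in its
discrete spectrum (`mem_discreteSpectrum_of_bound`). To see this, regard `T - t` as a bounded
operator on the graph of `T`: its kernel `N` is finite-dimensional and its range is closed, so it is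
bounded below on the part of the domain orthogonal to `N`. Since `N` and its complement are both
invariant, `T - s` is bounded below for `s ≠ t` near `t`.

For `t = k² ≥ 0`, the functions `η(εx) exp(ikx)` on an infinite edge, with `η` a cutoff, lie in the
domain for all vertex conditions and form a Weyl sequence as `ε → 0` (`not_exists_integral_le`). A
bounded resolvent would forbid this (`exists_integral_le_of_mem_resolventSet`). So all of `[0, ∞)`
is spectrum, and none of its points is isolated. -/

/-! ### Closed range and lower bounds for bounded operators -/

lemma Submodule.isClosed_map_of_bound {Y Z : Type*} [NormedAddCommGroup Y] [NormedSpace ℂ Y]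
    [CompleteSpace Y] [NormedAddCommGroup Z] [NormedSpace ℂ Z] (S : Y →L[ℂ] Z) (K : Submodule ℂ Y)
    (hK : IsClosed (K : Set Y)) (C : NNReal) (h : ∀ p ∈ K, ‖p‖ ≤ C * ‖S p‖) :
    IsClosed (K.map S.toLinearMap : Set Z) := by
  have : CompleteSpace K := hK.completeSpace_coe
  have hanti : AntilipschitzWith C (S.comp K.subtypeL) :=
    ContinuousLinearMap.antilipschitz_of_bound _ fun p => h p.1 p.2
  convert hanti.isClosed_range (S.comp K.subtypeL).uniformContinuous using 1
  ext x
  simp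

/-- By continuity the bound passes to the closure of `K`, whose image is then closed; the full range
exceeds that image by a finite-dimensional space only. -/
lemma ContinuousLinearMap.isClosed_range_of_bound_of_coFG {Y Z : Type*} [NormedAddCommGroup Y]
    [NormedSpace ℂ Y] [CompleteSpace Y] [NormedAddCommGroup Z] [NormedSpace ℂ Z] (S : Y →L[ℂ] Z)
    (K : Submodule ℂ Y) [hfg : K.CoFG] (C : NNReal) (h : ∀ p ∈ K, ‖p‖ ≤ C * ‖S p‖) :
    IsClosed (LinearMap.range S.toLinearMap : Set Z) := by
  have h' : ∀ p ∈ K.topologicalClosure, ‖p‖ ≤ C * ‖S p‖ := fun p hp =>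
    closure_minimal (t := {p : Y | ‖p‖ ≤ C * ‖S p‖}) h
      (isClosed_le continuous_norm (continuous_const.mul S.continuous.norm)) hp
  have : K.topologicalClosure.CoFG := hfg.of_le K.le_topologicalClosure
  exact LinearMap.isClosed_range_of_isClosed_map_of_finiteDimensional_quotient
    (Submodule.isClosed_map_of_bound S _ K.isClosed_topologicalClosure C h')

/-- This is the open mapping theorem for `S` restricted to `K`, as a map onto its closed image. -/
lemma Submodule.exists_bound_of_isClosed_map {Y Z : Type*} [NormedAddCommGroup Y]
    [NormedSpace ℂ Y] [CompleteSpace Y] [NormedAddCommGroup Z] [NormedSpace ℂ Z] [CompleteSpace Z]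
    (S : Y →L[ℂ] Z) (K : Submodule ℂ Y) (hK : IsClosed (K : Set Y))
    (hinj : ∀ p ∈ K, S p = 0 → p = 0) (hmap : IsClosed (K.map S.toLinearMap : Set Z)) :
    ∃ C : NNReal, ∀ p ∈ K, ‖p‖ ≤ C * ‖S p‖ := by
  have : CompleteSpace K := hK.completeSpace_coe
  obtain ⟨C, hC⟩ := ContinuousLinearMap.antilipschitz_of_injective_of_isClosed_range
    (S.comp K.subtypeL) ((injective_iff_map_eq_zero _).mpr fun p hp =>
      Subtype.ext (hinj p.1 p.2 hp)) (by convert hmap using 1; ext x; simp)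
  refine ⟨C, fun p hp => ?_⟩
  have h := hC.le_mul_norm_sub ⟨p, hp⟩ 0
  rwa [map_zero, add_zero, add_zero, norm_neg, norm_neg] at h

/-! ### Resolvent set and discrete spectrum of a self-adjoint operator -/

namespace UnboundedOperator

open scoped InnerProductSpace ComplexConjugate

variable {X : Type*} [NormedAddCommGroup X] [InnerProductSpace ℂ X] {T : X →ₗ.[ℂ] X}

/-- The graph of `T`, as a subspace of the normed space `X × X`. -/
def graphSpace (T : X →ₗ.[ℂ] X) : Submodule ℂ (X × X) := T.graph

lemma mk_mem_graphSpace (u : T.domain) : ((u : X), T u) ∈ graphSpace T := T.mem_graph u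

lemma exists_eq_of_mem_graphSpace {p : X × X} (hp : p ∈ graphSpace T) :
    ∃ u : T.domain, (u : X) = p.1 ∧ T u = p.2 := T.mem_graph_iff.mp hp

/-- The operator `T - z`, as a bounded operator on the graph of `T`. -/
noncomputable def graphSub (T : X →ₗ.[ℂ] X) (z : ℂ) : graphSpace T →L[ℂ] X :=
  (ContinuousLinearMap.snd ℂ X X - z • ContinuousLinearMap.fst ℂ X X).comp (graphSpace T).subtypeL

lemma graphSub_apply (z : ℂ) (p : graphSpace T) : graphSub T z p = p.1.2 - z • p.1.1 := rfl

/-- A bound for the inverse of `graphSub T z`, in terms of a lower bound `c` for `T - z`. -/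
noncomputable def graphBound (z : ℂ) (c : ℝ) : NNReal := Real.toNNReal (c⁻¹ + 1 + ‖z‖ * c⁻¹)

/-- The graph carries the maximum norm. The first component is controlled by `c⁻¹`, the second, via
`Tu = (T - z)u + zu`, by `1 + ‖z‖ c⁻¹`; `graphBound` is the sum of the two. -/
lemma norm_graph_le {z : ℂ} {c : ℝ} (hc : 0 < c) {p : graphSpace T}
    (h : c * ‖p.1.1‖ ≤ ‖graphSub T z p‖) :
    ‖p‖ ≤ graphBound z c * ‖graphSub T z p‖ := by
  rw [graphBound, Real.coe_toNNReal _ (by positivity)]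
  have h1 : ‖p.1.1‖ ≤ c⁻¹ * ‖graphSub T z p‖ := by
    rw [inv_mul_eq_div, le_div_iff₀ hc]; linarith
  have h2 : ‖p.1.2‖ ≤ ‖graphSub T z p‖ + ‖z‖ * (c⁻¹ * ‖graphSub T z p‖) := by
    calc ‖p.1.2‖ = ‖graphSub T z p + z • p.1.1‖ := by rw [graphSub_apply, sub_add_cancel]
      _ ≤ ‖graphSub T z p‖ + ‖z‖ * ‖p.1.1‖ := (norm_add_le _ _).trans (by rw [norm_smul])
      _ ≤ _ := by gcongr
  have hn := norm_nonneg (graphSub T z p)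
  have hz : 0 ≤ ‖z‖ * (c⁻¹ * ‖graphSub T z p‖) := by positivity
  have hci : 0 ≤ c⁻¹ * ‖graphSub T z p‖ := by positivity
  change max ‖p.1.1‖ ‖p.1.2‖ ≤ _
  refine max_le ?_ ?_ <;> nlinarith

lemma mem_range_graphSub {z : ℂ} (u : T.domain) :
    T u - z • (u : X) ∈ LinearMap.range (graphSub T z).toLinearMap :=
  ⟨⟨(u, T u), mk_mem_graphSpace u⟩, rfl⟩

lemma mem_eigenspace {z : ℂ} {u : T.domain} : u ∈ eigenspace T z ↔ T u = z • (u : X) := by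
  rw [eigenspace, LinearMap.mem_ker]
  exact sub_eq_zero

variable [CompleteSpace X]

lemma completeSpace_graph (hT : IsSelfAdjoint T) : CompleteSpace (graphSpace T) :=
  
  (show IsClosed (graphSpace T : Set (X × X)) from hT.isClosed).completeSpace_coe

lemma isSymmetric (hT : IsSelfAdjoint T) (u v : T.domain) : ⟪T u, v⟫_ℂ = ⟪(u : X), T v⟫_ℂ := by
  have h := LinearPMap.adjoint_isFormalAdjoint (T := T) hT.dense_domain
  rw [LinearPMap.isSelfAdjoint_def.mp hT] at h
  exact h u v

/-- The lower bound gives injectivity, closed range and the norm of the inverse. A vector `y`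
orthogonal to the range lies in the domain of the adjoint, which is `T`, and satisfies `Ty = conj z
• y`, so `h'` forces `y = 0` and the range is everything. -/
lemma mem_resolventSet_of_bound (hT : IsSelfAdjoint T) {z : ℂ} {c : ℝ} (hc : 0 < c)
    (h : ∀ u : T.domain, c * ‖(u : X)‖ ≤ ‖T u - z • (u : X)‖)
    (h' : ∀ u : T.domain, T u = conj z • (u : X) → (u : X) = 0) : z ∈ resolventSet T := by
  have hcl : IsClosed (LinearMap.range (graphSub T z).toLinearMap : Set X) := by
    have := completeSpace_graph hT
    rw [← Submodule.map_top]
    refine Submodule.isClosed_map_of_bound _ ⊤ isClosed_univ (graphBound z c) fun p _ =>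
      norm_graph_le hc ?_
    obtain ⟨u, hu, hu'⟩ := exists_eq_of_mem_graphSpace p.2
    rw [graphSub_apply, ← hu, ← hu']
    exact h u
  have htop : LinearMap.range (graphSub T z).toLinearMap = ⊤ := by
    have : CompleteSpace (LinearMap.range (graphSub T z).toLinearMap) := hcl.completeSpace_coe
    rw [← Submodule.orthogonal_eq_bot_iff, Submodule.eq_bot_iff]
    intro y hy
    have hy' : ∀ u : T.domain, ⟪conj z • y, u⟫_ℂ = ⟪y, T u⟫_ℂ := by
      intro u
      have := (Submodule.mem_orthogonal' _ _).mp hy _ (mem_range_graphSub u)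
      rw [inner_sub_right, inner_smul_right, sub_eq_zero] at this
      rw [inner_smul_left, Complex.conj_conj, this]
    have hmem : y ∈ (LinearPMap.adjoint T).domain :=
      LinearPMap.mem_adjoint_domain_of_exists y ⟨_, hy'⟩
    have hTy := LinearPMap.adjoint_apply_eq (T := T) hT.dense_domain ⟨y, hmem⟩ hy'
    -- Replacing the adjoint by a variable `S` allows the equality with `T` to be substituted
    -- although membership proofs depend on it.
    have hdom : ∀ S : X →ₗ.[ℂ] X, S = T → ∀ m : y ∈ S.domain, S ⟨y, m⟩ = conj z • y →
        ∃ m' : y ∈ T.domain, T ⟨y, m'⟩ = conj z • y := by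
      rintro S rfl m hm; exact ⟨m, hm⟩
    obtain ⟨m', hm'⟩ := hdom _ (LinearPMap.isSelfAdjoint_def.mp hT) hmem hTy
    exact h' ⟨y, m'⟩ hm'
  let L : T.domain →ₗ[ℂ] X := T.toFun - z • T.domain.subtype
  have hL : ∀ u : T.domain, L u = T u - z • (u : X) := fun u => rfl
  have hinj : Function.Injective L := by
    rw [← LinearMap.ker_eq_bot, LinearMap.ker_eq_bot']
    intro u hu
    have := h u
    rw [← hL, hu, norm_zero] at this
    have h0 : ‖(u : X)‖ ≤ 0 := by
      by_contra hcon
      push Not at hcon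
      nlinarith [mul_pos hc hcon]
    exact Subtype.ext (norm_le_zero_iff.mp h0)
  have hsurj : Function.Surjective L := by
    intro f
    have : f ∈ LinearMap.range (graphSub T z).toLinearMap := htop ▸ Submodule.mem_top
    obtain ⟨p, rfl⟩ := this
    obtain ⟨u, hu, hu'⟩ := exists_eq_of_mem_graphSpace p.2
    exact ⟨u, by rw [hL, hu, hu']; rfl⟩
  let e := LinearEquiv.ofBijective L ⟨hinj, hsurj⟩
  refine ⟨(T.domain.subtype.comp e.symm.toLinearMap).mkContinuous c⁻¹ fun f => ?_, fun f => ?_,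
    fun u => ?_⟩
  · have := h (e.symm f)
    rw [← hL, show L (e.symm f) = f from e.apply_symm_apply f] at this
    rw [inv_mul_eq_div, le_div_iff₀ hc, mul_comm]
    exact this
  · exact ⟨(e.symm f).2, e.apply_symm_apply f⟩
  · exact congrArg Subtype.val (e.symm_apply_apply u)

/-- Symmetry makes `⟪u, Tu⟫` real, so `⟪u, (T - z)u⟫` has imaginary part `-Im z ‖u‖²`;
Cauchy–Schwarz does the rest. -/
lemma abs_im_mul_norm_le (hT : IsSelfAdjoint T) (z : ℂ) (u : T.domain) :
    |z.im| * ‖(u : X)‖ ≤ ‖T u - z • (u : X)‖ := by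
  have him : (⟪(u : X), T u⟫_ℂ).im = 0 := by
    have := isSymmetric hT u u
    rw [← inner_conj_symm] at this
    exact Complex.conj_eq_iff_im.mp this
  have h1 : (⟪(u : X), T u - z • (u : X)⟫_ℂ).im = - z.im * ‖(u : X)‖ ^ 2 := by
    rw [inner_sub_right, inner_smul_right, inner_self_eq_norm_sq_to_K, ← RCLike.ofReal_pow,
      RCLike.ofReal_eq_complex_ofReal, Complex.sub_im, him, Complex.im_mul_ofReal]
    ring
  have h2 : |z.im| * ‖(u : X)‖ ^ 2 ≤ ‖(u : X)‖ * ‖T u - z • (u : X)‖ := by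
    calc |z.im| * ‖(u : X)‖ ^ 2 = |(⟪(u : X), T u - z • (u : X)⟫_ℂ).im| := by
          rw [h1, abs_mul, abs_neg, abs_of_nonneg (sq_nonneg ‖(u : X)‖)]
      _ ≤ _ := (Complex.abs_im_le_norm _).trans (norm_inner_le_norm _ _)
  rcases eq_or_lt_of_le (norm_nonneg (u : X)) with h0 | h0
  · rw [← h0, mul_zero]; exact norm_nonneg _
  · nlinarith

lemma mem_resolventSet_of_im_ne_zero (hT : IsSelfAdjoint T) {z : ℂ} (hz : z.im ≠ 0) :
    z ∈ resolventSet T := by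
  refine mem_resolventSet_of_bound hT (abs_pos.mpr hz) (abs_im_mul_norm_le hT z) fun u hu => ?_
  have := abs_im_mul_norm_le hT (conj z) u
  rw [hu, sub_self, norm_zero, Complex.conj_im, abs_neg] at this
  have hp := abs_pos.mpr hz
  by_contra hne
  have := mul_pos hp (norm_pos_iff.mpr hne)
  linarith

lemma mem_resolventSet_of_real_bound (hT : IsSelfAdjoint T) {t : ℝ} {c : ℝ} (hc : 0 < c)
    (h : ∀ u : T.domain, c * ‖(u : X)‖ ≤ ‖T u - (t : ℂ) • (u : X)‖) :
    (t : ℂ) ∈ resolventSet T := by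
  refine mem_resolventSet_of_bound hT hc h fun u hu => ?_
  rw [Complex.conj_ofReal] at hu
  have := h u
  rw [hu, sub_self, norm_zero] at this
  by_contra hne
  have := mul_pos hc (norm_pos_iff.mpr hne)
  linarith

/-! ### Lower bounds on subspaces of finite codimension -/

section FiniteCodimension

variable {W : Type*} [AddCommGroup W] [Module ℂ W] [FiniteDimensional ℂ W]

omit [CompleteSpace X] in
-- An eigenvector killed by `τ` would violate the bound, so `τ` embeds the eigenspace in `W`.
lemma finiteDimensional_eigenspace_of_bound {z : ℂ} {c : ℝ} (hc : 0 < c)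
    (τ : T.domain →ₗ[ℂ] W)
    (h : ∀ u : T.domain, τ u = 0 → c * ‖(u : X)‖ ≤ ‖T u - z • (u : X)‖) :
    FiniteDimensional ℂ (eigenspace T z) := by
  refine FiniteDimensional.of_injective (τ.comp (eigenspace T z).subtype) ?_
  rw [← LinearMap.ker_eq_bot, LinearMap.ker_eq_bot']
  intro u hu
  have := h u.1 hu
  rw [mem_eigenspace.mp u.2, sub_self, norm_zero] at this
  by_contra hne
  have : (u.1 : X) ≠ 0 := fun h0 => hne (Subtype.ext (Subtype.ext h0))
  have := mul_pos hc (norm_pos_iff.mpr this)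
  linarith

lemma isClosed_range_graphSub (hT : IsSelfAdjoint T) {z : ℂ} {c : ℝ} (hc : 0 < c)
    (τ : T.domain →ₗ[ℂ] W)
    (h : ∀ u : T.domain, τ u = 0 → c * ‖(u : X)‖ ≤ ‖T u - z • (u : X)‖) :
    IsClosed (LinearMap.range (graphSub T z).toLinearMap : Set X) := by
  have := completeSpace_graph hT
  let π : graphSpace T →ₗ[ℂ] T.domain :=
    ((LinearMap.fst ℂ X X).comp (graphSpace T).subtype).codRestrict T.domain fun p =>
      LinearPMap.mem_domain_of_mem_graph p.2
  have : (LinearMap.ker (τ.comp π)).CoFG :=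
    have : FiniteDimensional ℂ (graphSpace T ⧸ LinearMap.ker (τ.comp π)) :=
      (LinearMap.quotKerEquivRange (τ.comp π)).symm.finiteDimensional
    this
  refine (graphSub T z).isClosed_range_of_bound_of_coFG (LinearMap.ker (τ.comp π))
    (graphBound z c) fun p hp => norm_graph_le hc ?_
  obtain ⟨u, hu, hu'⟩ := exists_eq_of_mem_graphSpace p.2
  rw [graphSub_apply, ← hu, ← hu']
  refine h u ?_
  rw [← show π p = u from Subtype.ext hu.symm]
  exact hp

omit [CompleteSpace X] in
-- The projection onto the eigenspace stays in the domain of `T`, hence so does the remainder `u -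
-- n`.
lemma exists_eigenspace_add_orthogonal (z : ℂ) [FiniteDimensional ℂ (eigenspace T z)]
    (u : T.domain) : ∃ n ∈ eigenspace T z, ∃ q : T.domain,
      (q : X) ∈ ((eigenspace T z).map T.domain.subtype)ᗮ ∧ n + q = u := by
  set N := (eigenspace T z).map T.domain.subtype
  obtain ⟨n, hn, hnu⟩ := Submodule.coe_mem (N.orthogonalProjectionOnto (u : X))
  refine ⟨n, hn, u - n, ?_, add_sub_cancel _ _⟩
  have := N.sub_starProjection_mem_orthogonal (u : X)
  rw [Submodule.starProjection_apply, ← hnu] at this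
  exact this

/-- Orthogonally to its kernel `T - z` is injective, and it has the same range there as on the whole
domain. That range is closed, so the open mapping theorem provides `c'`. -/
lemma exists_bound_of_orthogonal_eigenspace (hT : IsSelfAdjoint T) {z : ℂ} {c : ℝ} (hc : 0 < c)
    (τ : T.domain →ₗ[ℂ] W)
    (h : ∀ u : T.domain, τ u = 0 → c * ‖(u : X)‖ ≤ ‖T u - z • (u : X)‖) :
    ∃ c' > 0, ∀ u : T.domain, (u : X) ∈ ((eigenspace T z).map T.domain.subtype)ᗮ →
      c' * ‖(u : X)‖ ≤ ‖T u - z • (u : X)‖ := by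
  have := completeSpace_graph hT
  have := finiteDimensional_eigenspace_of_bound hc τ h
  set N := (eigenspace T z).map T.domain.subtype
  let S : Submodule ℂ (graphSpace T) := Nᗮ.comap ((LinearMap.fst ℂ X X).comp (graphSpace T).subtype)
  have hScl : IsClosed (S : Set (graphSpace T)) :=
    (Submodule.isClosed_orthogonal N).preimage (continuous_fst.comp continuous_subtype_val)
  have hinj : ∀ p ∈ S, graphSub T z p = 0 → p = 0 := by
    intro p hp hp0
    obtain ⟨u, hu, hu'⟩ := exists_eq_of_mem_graphSpace p.2
    have hpN : p.1.1 ∈ N := by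
      refine ⟨u, mem_eigenspace.mpr ?_, hu⟩
      rw [hu, hu']
      exact sub_eq_zero.mp hp0
    have h0 : p.1.1 = 0 := inner_self_eq_zero.mp ((Submodule.mem_orthogonal _ _).mp hp _ hpN)
    have hu0 : u = 0 := Subtype.ext (hu.trans h0)
    refine Subtype.ext (Prod.ext h0 ?_)
    rw [← hu', hu0, LinearPMap.map_zero]; rfl
  have hrange : S.map (graphSub T z).toLinearMap =
      LinearMap.range (graphSub T z).toLinearMap := by
    refine le_antisymm LinearMap.map_le_range ?_
    rintro _ ⟨p, rfl⟩
    obtain ⟨u, hu, hu'⟩ := exists_eq_of_mem_graphSpace p.2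
    obtain ⟨n, hn, q, hq, rfl⟩ := exists_eigenspace_add_orthogonal z u
    refine ⟨⟨((q : X), T q), mk_mem_graphSpace q⟩, hq, ?_⟩
    change T q - z • (q : X) = p.1.2 - z • p.1.1
    rw [← hu, ← hu', LinearPMap.map_add, mem_eigenspace.mp hn, Submodule.coe_add, smul_add]
    abel
  obtain ⟨K, hK⟩ := S.exists_bound_of_isClosed_map (graphSub T z) hScl hinj
    (hrange ▸ isClosed_range_graphSub hT hc τ h)
  -- The `+ 1` keeps the constant positive even if `K = 0`.
  refine ⟨((K : ℝ) + 1)⁻¹, by positivity, fun u hu => ?_⟩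
  have hb : ‖(u : X)‖ ≤ K * ‖T u - z • (u : X)‖ :=
    (norm_fst_le ((u : X), T u)).trans (hK ⟨(u, T u), mk_mem_graphSpace u⟩ hu)
  rw [inv_mul_eq_div, div_le_iff₀ (by positivity)]
  nlinarith [norm_nonneg (T u - z • (u : X))]

/-- If `T - t` is bounded below on a subspace of finite codimension in the domain of the
self-adjoint operator `T`, then `t` is not in the essential spectrum of `T`. -/
theorem mem_discreteSpectrum_of_bound (hT : IsSelfAdjoint T) {t : ℝ} {c : ℝ} (hc : 0 < c)
    (τ : T.domain →ₗ[ℂ] W)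
    (h : ∀ u : T.domain, τ u = 0 → c * ‖(u : X)‖ ≤ ‖T u - (t : ℂ) • (u : X)‖)
    (ht : (t : ℂ) ∈ spectrum T) : (t : ℂ) ∈ discreteSpectrum T := by
  have hfin := finiteDimensional_eigenspace_of_bound hc τ h
  obtain ⟨c', hc', hb⟩ := exists_bound_of_orthogonal_eigenspace hT hc τ h
  -- The lower bound `c'` on the complement of the eigenspace serves as the radius of isolation.
  refine ⟨ht, ⟨c', hc', fun w hw hwt => ?_⟩, fun hbot => ?_, hfin⟩
  · by_contra hne
    refine hw ?_
    by_cases him : w.im = 0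
    swap
    · exact mem_resolventSet_of_im_ne_zero hT him
    obtain ⟨s, rfl⟩ : ∃ s : ℝ, (s : ℂ) = w := ⟨w.re, Complex.ext rfl (by simp [him])⟩
    set N := (eigenspace T t).map T.domain.subtype with hN
    have hd : ‖(s : ℂ) - t‖ < c' := by rwa [← dist_eq_norm]
    have hd0 : 0 < ‖(s : ℂ) - t‖ := norm_pos_iff.mpr (sub_ne_zero.mpr hne)
    -- On the eigenspace `T - s` is multiplication by `t - s`; on its complement the shift from `t`
    -- to `s` costs at most `‖s - t‖` of the bound `c'`.
    set m := min ‖(s : ℂ) - t‖ (c' - ‖(s : ℂ) - t‖) with hm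
    have hm0 : 0 < m := lt_min hd0 (by linarith)
    refine mem_resolventSet_of_real_bound hT hm0 fun u => ?_
    obtain ⟨n, hn, q, hperp, hu⟩ := exists_eigenspace_add_orthogonal (T := T) (t : ℂ) u
    replace hu := hu.symm
    have hnN : (n : X) ∈ N := ⟨n, hn, rfl⟩
    have hTn := mem_eigenspace.mp hn
    have hinner : ⟪(n : X), (q : X)⟫_ℂ = 0 := (Submodule.mem_orthogonal _ _).mp hperp _ hnN
    -- `T` keeps the complement orthogonal to `n`, so Pythagoras applies both to `u` and to `(T -
    -- s)u`.
    have hTinner : ⟪(n : X), T q⟫_ℂ = 0 := by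
      rw [← isSymmetric hT, hTn, inner_smul_left, hinner, mul_zero]
    have hsplit : T u - (s : ℂ) • (u : X) =
        ((t : ℂ) - s) • (n : X) + (T q - (s : ℂ) • (q : X)) := by
      rw [hu, LinearPMap.map_add, hTn, Submodule.coe_add, smul_add, sub_smul]; abel
    have hq1 : m * ‖(q : X)‖ ≤ ‖T q - (s : ℂ) • (q : X)‖ := by
      have h1 := hb q hperp
      have h2 : ‖T q - (t : ℂ) • (q : X)‖ ≤
          ‖T q - (s : ℂ) • (q : X)‖ + ‖(s : ℂ) - t‖ * ‖(q : X)‖ := by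
        rw [← norm_smul]
        refine le_trans (le_of_eq ?_) (norm_add_le _ _)
        rw [sub_smul]; congr 1; abel
      have h3 : m * ‖(q : X)‖ ≤ (c' - ‖(s : ℂ) - t‖) * ‖(q : X)‖ := by
        gcongr; exact min_le_right _ _
      linarith
    have hn1 : m * ‖(n : X)‖ ≤ ‖((t : ℂ) - s) • (n : X)‖ := by
      rw [norm_smul, norm_sub_rev]
      gcongr; exact min_le_left _ _
    have e1 : ‖(u : X)‖ * ‖(u : X)‖ = ‖(n : X)‖ * ‖(n : X)‖ + ‖(q : X)‖ * ‖(q : X)‖ := by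
      rw [hu, Submodule.coe_add]
      exact norm_add_sq_eq_norm_sq_add_norm_sq_of_inner_eq_zero (𝕜 := ℂ) _ _ hinner
    have e2 : ‖T u - (s : ℂ) • (u : X)‖ * ‖T u - (s : ℂ) • (u : X)‖ =
        ‖((t : ℂ) - s) • (n : X)‖ * ‖((t : ℂ) - s) • (n : X)‖ +
          ‖T q - (s : ℂ) • (q : X)‖ * ‖T q - (s : ℂ) • (q : X)‖ := by
      rw [hsplit]
      refine norm_add_sq_eq_norm_sq_add_norm_sq_of_inner_eq_zero (𝕜 := ℂ) _ _ ?_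
      rw [inner_smul_left, inner_sub_right, inner_smul_right, hTinner, hinner]
      simp
    rw [← abs_of_nonneg (norm_nonneg (T u - (s : ℂ) • (u : X)))]
    refine (le_abs_self _).trans (sq_le_sq.mp ?_)
    have e3 : (m * ‖(u : X)‖) ^ 2 = m * m * (‖(u : X)‖ * ‖(u : X)‖) := by ring
    rw [e3, e1]
    have a1 := mul_self_le_mul_self (by positivity) hn1
    have a2 := mul_self_le_mul_self (by positivity) hq1
    nlinarith
  -- With trivial eigenspace the bound `c'` holds on the whole domain, which would put `t` in the
  -- resolvent set.
  · refine ht (mem_resolventSet_of_real_bound hT hc' fun u => hb u ?_)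
    rw [hbot, Submodule.map_bot, Submodule.bot_orthogonal_eq_top]
    exact Submodule.mem_top

end FiniteCodimension

end UnboundedOperator

/-! ### Weak derivatives and integration by parts on an interval -/

section IntegrationByParts

open Set intervalIntegral


/-- A smooth function with integral zero and compact support in an open interval is the derivative
of a smooth function with compact support in that interval. -/
lemma exists_primitive_of_integral_eq_zero {k : ℝ → ℝ} (hk : ContDiff ℝ ∞ k) {a b : ℝ}
    (hs : Function.support k ⊆ Icc a b) (hk0 : ∫ t, k t = 0) :
    ∃ Φ : ℝ → ℝ, ContDiff ℝ ∞ Φ ∧ HasCompactSupport Φ ∧ tsupport Φ ⊆ Icc a b ∧ deriv Φ = k := by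
  -- Starting at `a - 1` instead of `a` puts all of `[a, b]` inside the half-open interval of
  -- integration once `x > b`.
  have hd : ∀ x, HasDerivAt (fun x => ∫ t in (a - 1)..x, k t) (k x) x := fun x =>
    integral_hasDerivAt_right (hk.continuous.intervalIntegrable _ _)
      hk.continuous.stronglyMeasurable.stronglyMeasurableAtFilter hk.continuous.continuousAt
  have hderiv : deriv (fun x => ∫ t in (a - 1)..x, k t) = k := funext fun x => (hd x).deriv
  have hz : ∀ x, x ∉ Icc a b → ∫ t in (a - 1)..x, k t = 0 := by
    intro x hx
    by_cases h : x < a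
    · rw [integral_congr (g := fun _ => 0), intervalIntegral.integral_zero]
      intro t ht
      by_contra hne
      have := (hs hne).1
      have : t ≤ max (a - 1) x := ht.2
      grind
    · have hbx : b < x := by
        by_contra hbx
        exact hx ⟨not_lt.mp h, not_lt.mp hbx⟩
      rw [integral_of_le (by linarith), ← hk0]
      refine setIntegral_eq_integral_of_forall_compl_eq_zero fun t ht => ?_
      by_contra hne
      have := hs hne
      exact ht ⟨by linarith [this.1], by linarith [this.2]⟩
  have hts : tsupport (fun x => ∫ t in (a - 1)..x, k t) ⊆ Icc a b := by
    refine closure_minimal (fun x hx => ?_) isClosed_Icc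
    by_contra h
    exact hx (hz x h)
  refine ⟨fun x => ∫ t in (a - 1)..x, k t, ?_, HasCompactSupport.intro isCompact_Icc hz, hts,
    hderiv⟩
  rw [contDiff_infty_iff_deriv]
  exact ⟨fun x => (hd x).differentiableAt, by rw [hderiv]; exact hk⟩

/-- The du Bois-Reymond lemma: a continuous function with vanishing weak derivative is constant. -/
lemma eqOn_const_of_integral_deriv_mul_eq_zero {w : ℝ → ℝ} {b : ℝ} (hb : 0 < b)
    (hw : ContinuousOn w (Icc 0 b))
    (h : ∀ φ : ℝ → ℝ, ContDiff ℝ ∞ φ → HasCompactSupport φ → tsupport φ ⊆ Ioo 0 b →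
      ∫ x in Ioo 0 b, deriv φ x * w x = 0) : ∀ x ∈ Icc 0 b, w x = w 0 := by
  -- With `∫ ρ = 1`, every test function `φ` becomes a derivative of a test function after
  -- subtracting `(∫ φ) ρ`. Hence `w - c` is orthogonal to all `φ`, where `c = ∫ ρ w`.
  obtain ⟨ρ, hρs, hρc, hρ, hρ1⟩ : ∃ ρ : ℝ → ℝ, tsupport ρ ⊆ Ioo 0 b ∧ HasCompactSupport ρ ∧
      ContDiff ℝ ∞ ρ ∧ ∫ t, ρ t = 1 := by
    let B : ContDiffBump (b / 2) := ⟨b / 8, b / 4, by positivity, by linarith⟩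
    refine ⟨B.normed volume, ?_, B.hasCompactSupport_normed, B.contDiff_normed,
      B.integral_normed⟩
    rw [B.tsupport_normed_eq, Real.closedBall_eq_Icc]
    exact fun x hx => ⟨by have := hx.1; change b / 2 - b / 4 ≤ x at this; linarith,
      by have := hx.2; change x ≤ b / 2 + b / 4 at this; linarith⟩
  have hint : ∀ φ : ℝ → ℝ, Continuous φ → IntegrableOn (fun x => φ x * w x) (Ioo 0 b) := by
    intro φ hφ
    exact ((hφ.continuousOn.mul hw).integrableOn_Icc).mono_set Ioo_subset_Icc_self
  set c := ∫ x in Ioo 0 b, ρ x * w x with hc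
  have hwc : ContinuousOn (fun x => w x - c) (Icc 0 b) := hw.sub continuousOn_const
  have hae : ∀ᵐ x, x ∈ Ioo 0 b → w x - c = 0 := by
    refine isOpen_Ioo.ae_eq_zero_of_integral_contDiff_smul_eq_zero
      ((hwc.mono Ioo_subset_Icc_self).locallyIntegrableOn measurableSet_Ioo) ?_
    intro φ hφ hφc hφs
    -- A compact interval inside `(0, b)` is needed to contain the support of the primitive `Φ`.
    obtain ⟨α, β, hαβ, hα, hβ⟩ : ∃ α β : ℝ, tsupport φ ∪ tsupport ρ ⊆ Icc α β ∧ 0 < α ∧ β < b := by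
      have hK : IsCompact (tsupport φ ∪ tsupport ρ) := hφc.isCompact.union hρc.isCompact
      have hne : (tsupport φ ∪ tsupport ρ).Nonempty := by
        by_contra hcon
        rw [not_nonempty_iff_eq_empty, union_empty_iff] at hcon
        rw [tsupport_eq_empty_iff.mp hcon.2] at hρ1
        simp at hρ1
      have hsub := union_subset hφs hρs
      exact ⟨_, _, fun x hx => ⟨csInf_le hK.bddBelow hx, le_csSup hK.bddAbove hx⟩,
        (hsub (hK.sInf_mem hne)).1, (hsub (hK.sSup_mem hne)).2⟩
    have hφi : Integrable φ := hφ.continuous.integrable_of_hasCompactSupport hφc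
    have hρi : Integrable ρ := hρ.continuous.integrable_of_hasCompactSupport hρc
    obtain ⟨Φ, hΦ, hΦc, hΦs, hΦd⟩ := exists_primitive_of_integral_eq_zero
      (k := fun x => φ x - (∫ t, φ t) * ρ x) (a := α) (b := β)
      (hφ.sub (contDiff_const.mul hρ)) (by
        intro x hx
        apply hαβ
        by_contra hcon
        rw [mem_union, not_or] at hcon
        exact hx (by
          simp only [image_eq_zero_of_notMem_tsupport hcon.1,
            image_eq_zero_of_notMem_tsupport hcon.2, mul_zero, sub_zero]))
      (by rw [integral_sub hφi (hρi.const_mul _), MeasureTheory.integral_const_mul, hρ1]; ring)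
    have h0 := h Φ hΦ hΦc (hΦs.trans (Icc_subset_Ioo hα hβ))
    rw [hΦd] at h0
    have e1 : ∫ x in Ioo 0 b, (φ x - (∫ t, φ t) * ρ x) * w x =
        (∫ x in Ioo 0 b, φ x * w x) - (∫ t, φ t) * c := by
      rw [hc, ← MeasureTheory.integral_const_mul, ← integral_sub (hint φ hφ.continuous)
        ((hint ρ hρ.continuous).const_mul _)]
      congr 1; ext x; ring
    have e2 : ∫ x, φ x • (w x - c) = ∫ x in Ioo 0 b, φ x * (w x - c) := by
      symm
      refine setIntegral_eq_integral_of_forall_compl_eq_zero fun x hx => ?_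
      rw [image_eq_zero_of_notMem_tsupport (fun hx' => hx (hφs hx')), zero_mul]
    have e3 : ∫ x in Ioo 0 b, φ x = ∫ x, φ x :=
      setIntegral_eq_integral_of_forall_compl_eq_zero fun x hx =>
        image_eq_zero_of_notMem_tsupport (fun hx' => hx (hφs hx'))
    rw [e2]
    simp_rw [mul_sub]
    rw [integral_sub (hint φ hφ.continuous) (hφi.integrableOn.mul_const c), MeasureTheory.integral_mul_const, e3,
      ← e1, h0]
  have heq : EqOn w (fun _ => c) (Icc 0 b) := by
    have h1 : EqOn w (fun _ => c) (Ioo 0 b) := by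
      refine Measure.eqOn_open_of_ae_eq (μ := volume) ?_ isOpen_Ioo (hw.mono Ioo_subset_Icc_self)
        continuousOn_const
      rw [Filter.EventuallyEq, ae_restrict_iff' measurableSet_Ioo]
      filter_upwards [hae] with x hx hxm using sub_eq_zero.mp (hx hxm)
    exact h1.of_subset_closure hw continuousOn_const Ioo_subset_Icc_self
      (by rw [closure_Ioo hb.ne])
  intro x hx
  rw [heq hx, heq (left_mem_Icc.mpr hb.le)]

/-- A continuous function with an integrable weak derivative is a primitive of it. -/
lemma eq_add_integral_of_weakDeriv {f g : ℝ → ℝ} {b : ℝ} (hb : 0 < b)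
    (hf : ContinuousOn f (Icc 0 b)) (hg : IntervalIntegrable g volume 0 b)
    (h : ∀ φ : ℝ → ℝ, ContDiff ℝ ∞ φ → HasCompactSupport φ → tsupport φ ⊆ Ioo 0 b →
      ∫ x in Ioo 0 b, deriv φ x * f x = - ∫ x in Ioo 0 b, φ x * g x) :
    ∀ x ∈ Icc 0 b, f x = f 0 + ∫ t in 0..x, g t := by
  have hac := hg.absolutelyContinuousOnInterval_intervalIntegral (c := 0) (by simp)
  have hPc : ContinuousOn (fun x => ∫ t in 0..x, g t) (Icc 0 b) := by
    have := hac.continuousOn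
    rwa [uIcc_of_le hb.le] at this
  -- The primitive of `g` is absolutely continuous with weak derivative `g`, so its difference from
  -- `f` has weak derivative zero.
  have hconst := eqOn_const_of_integral_deriv_mul_eq_zero hb (hf.sub hPc) (by
    intro φ hφ hc hs
    have hφac : AbsolutelyContinuousOnInterval φ 0 b :=
      (hφ.of_le (by simp)).contDiffOn.absolutelyContinuousOnInterval
    have hparts := hφac.integral_mul_deriv_eq_deriv_mul hac
    have h0 : φ 0 = 0 := image_eq_zero_of_notMem_tsupport fun hx => lt_irrefl _ (hs hx).1
    have h1 : φ b = 0 := image_eq_zero_of_notMem_tsupport fun hx => lt_irrefl _ (hs hx).2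
    have hder : ∫ x in 0..b, φ x * deriv (fun x => ∫ t in 0..x, g t) x = ∫ x in 0..b, φ x * g x := by
      refine integral_congr_ae ?_
      filter_upwards [hg.ae_hasDerivAt_integral] with x hx hxm
      rw [(hx (uIoc_subset_uIcc hxm) 0 (by simp)).deriv]
    rw [hder, h0, h1, zero_mul, zero_mul, sub_zero, zero_sub] at hparts
    have hd : Continuous (deriv φ) := hφ.continuous_deriv (by simp)
    have i1 : IntegrableOn (fun x => deriv φ x * f x) (Ioo 0 b) :=
      ((hd.continuousOn.mul hf).integrableOn_Icc).mono_set Ioo_subset_Icc_self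
    have i2 : IntegrableOn (fun x => deriv φ x * ∫ t in 0..x, g t) (Ioo 0 b) :=
      ((hd.continuousOn.mul hPc).integrableOn_Icc).mono_set Ioo_subset_Icc_self
    have := h φ hφ hc hs
    simp only [Pi.sub_apply, mul_sub]
    rw [integral_sub i1 i2, this]
    rw [integral_of_le hb.le, integral_of_le hb.le, integral_Ioc_eq_integral_Ioo,
      integral_Ioc_eq_integral_Ioo] at hparts
    rw [hparts]; ring)
  intro x hx
  have := hconst x hx
  simp only [Pi.sub_apply, integral_same, sub_zero] at this
  linarith

/-- Integration by parts for a function with two weak derivatives. -/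
lemma mul_sub_mul_eq_integral {f g h : ℝ → ℝ} {b : ℝ} (hb : 0 < b)
    (hg : IntervalIntegrable g volume 0 b) (hh : IntervalIntegrable h volume 0 b)
    (hf : ∀ x ∈ Icc 0 b, f x = f 0 + ∫ t in 0..x, g t)
    (hg' : ∀ x ∈ Icc 0 b, g x = g 0 + ∫ t in 0..x, h t) :
    f b * g b - f 0 * g 0 = ∫ x in 0..b, (g x * g x + f x * h x) := by
  have hac : ∀ (k : ℝ → ℝ), IntervalIntegrable k volume 0 b → ∀ c : ℝ,
      AbsolutelyContinuousOnInterval (fun x => c + ∫ t in 0..x, k t) 0 b := fun k hk c =>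
    AbsolutelyContinuousOnInterval.add (contDiff_const.contDiffOn.absolutelyContinuousOnInterval)
      (hk.absolutelyContinuousOnInterval_intervalIntegral (c := 0) (by simp))
  have hd : ∀ (k : ℝ → ℝ), IntervalIntegrable k volume 0 b → ∀ c : ℝ, ∀ᵐ x, x ∈ uIcc 0 b →
      deriv (fun x => c + ∫ t in 0..x, k t) x = k x := fun k hk c => by
    filter_upwards [hk.ae_hasDerivAt_integral] with x hx hxm
    exact ((hx hxm 0 (by simp)).const_add c).deriv
  have hparts := (hac g hg (f 0)).integral_deriv_mul_eq_sub (hac h hh (g 0))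
  rw [← hf b (right_mem_Icc.mpr hb.le), ← hg' b (right_mem_Icc.mpr hb.le), integral_same,
    integral_same, add_zero, add_zero] at hparts
  rw [← hparts]
  refine integral_congr_ae ?_
  filter_upwards [hd g hg (f 0), hd h hh (g 0)] with x h1 h2 hxm
  have hxm' := uIoc_subset_uIcc hxm
  have hx : x ∈ Icc 0 b := by rwa [uIcc_of_le hb.le] at hxm'
  rw [h1 hxm', h2 hxm', ← hf x hx, ← hg' x hx]

end IntegrationByParts

/-! ### Nonnegativity of the second-derivative form on an edge -/

namespace MetricGraph

variable {V E : Type*} {G : MetricGraph V E}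

section Edge

open Set Filter Topology

lemma openEdge_of_eq_top {e : E} (h : G.length e = ⊤) : G.openEdge e = Ioi 0 := by
  ext x; simp [openEdge, h]

lemma closedEdge_of_eq_top {e : E} (h : G.length e = ⊤) : G.closedEdge e = Ici 0 := by
  ext x; simp [closedEdge, h]

lemma openEdge_of_ne_top {e : E} (h : G.length e ≠ ⊤) :
    G.openEdge e = Ioo 0 (G.length e).toReal := by
  ext x
  refine and_congr_right fun hx => ?_
  rw [ENNReal.ofReal_lt_iff_lt_toReal hx.le h]

lemma closedEdge_of_ne_top {e : E} (h : G.length e ≠ ⊤) :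
    G.closedEdge e = Icc 0 (G.length e).toReal := by
  ext x
  exact and_congr_right fun hx => ENNReal.ofReal_le_iff_le_toReal h

lemma length_toReal_pos {e : E} (h : G.length e ≠ ⊤) : 0 < (G.length e).toReal :=
  ENNReal.toReal_pos (G.length_pos e).ne' h

lemma openEdge_subset_closedEdge (e : E) : G.openEdge e ⊆ G.closedEdge e :=
  fun _ hx => ⟨hx.1.le, hx.2.le⟩

lemma closure_openEdge (e : E) : closure (G.openEdge e) = G.closedEdge e := by
  by_cases h : G.length e = ⊤
  · rw [openEdge_of_eq_top h, closedEdge_of_eq_top h, closure_Ioi]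
  · rw [openEdge_of_ne_top h, closedEdge_of_ne_top h, closure_Ioo (length_toReal_pos h).ne]

lemma endCoord_mem_closedEdge (a : G.EdgeEnd) : G.endCoord a ∈ G.closedEdge (G.endEdge a) := by
  rcases a with e | e
  · exact ⟨le_rfl, by simp [endCoord]⟩
  · exact ⟨ENNReal.toReal_nonneg, by simp [endCoord, endEdge, ENNReal.ofReal_toReal e.2]⟩

/-- The continuous representative of a function is unique. -/
lemma IsContinuousRep.eqOn {ψ : G.L2} {F₁ F₂ : E → ℝ → ℂ} (h₁ : G.IsContinuousRep ψ F₁)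
    (h₂ : G.IsContinuousRep ψ F₂) (e : E) : EqOn (F₁ e) (F₂ e) (G.closedEdge e) := by
  have hopen : EqOn (F₁ e) (F₂ e) (G.openEdge e) :=
    Measure.eqOn_open_of_ae_eq (μ := volume) ((h₁ e).2.symm.trans (h₂ e).2) (isOpen_openEdge e)
      ((h₁ e).1.mono (openEdge_subset_closedEdge e)) ((h₂ e).1.mono (openEdge_subset_closedEdge e))
  exact hopen.of_subset_closure (h₁ e).1 (h₂ e).1 (openEdge_subset_closedEdge e)
    (closure_openEdge e).ge

/-- Weak differentiability of real functions on an edge. -/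
def HasRealWeakDeriv (G : MetricGraph V E) (e : E) (f g : ℝ → ℝ) : Prop :=
  ∀ φ : ℝ → ℝ, ContDiff ℝ ∞ φ → HasCompactSupport φ → tsupport φ ⊆ G.openEdge e →
    ∫ x, deriv φ x * f x ∂G.edgeMeasure e = - ∫ x, φ x * g x ∂G.edgeMeasure e

lemma setIntegral_mul_eq_of_support {s t : Set ℝ} {φ f : ℝ → ℝ} (hst : s ⊆ t)
    (hφ : Function.support φ ⊆ s) : ∫ x in s, φ x * f x = ∫ x in t, φ x * f x := by
  have key : ∀ r, s ⊆ r → ∫ x in r, φ x * f x = ∫ x, φ x * f x := fun r hr =>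
    setIntegral_eq_integral_of_forall_compl_eq_zero fun x hx => by
      rw [Function.notMem_support.mp fun h => hx (hr (hφ h)), zero_mul]
  rw [key s subset_rfl, key t hst]

lemma HasRealWeakDeriv.eq_add_integral {e : E} {f g : ℝ → ℝ} (h : G.HasRealWeakDeriv e f g)
    {b : ℝ} (hb : 0 < b) (ho : Ioo 0 b ⊆ G.openEdge e) (hf : ContinuousOn f (Icc 0 b))
    (hg : IntervalIntegrable g volume 0 b) :
    ∀ x ∈ Icc 0 b, f x = f 0 + ∫ t in 0..x, g t := by
  refine eq_add_integral_of_weakDeriv hb hf hg fun φ hφ hc hs => ?_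
  rw [setIntegral_mul_eq_of_support ho
      ((subset_tsupport _).trans ((tsupport_deriv_subset).trans hs)),
    setIntegral_mul_eq_of_support ho ((subset_tsupport _).trans hs)]
  exact h φ hφ hc (hs.trans ho)

/-- For a function on an edge which vanishes at the endpoints, the second derivative has a
nonpositive quadratic form. -/
lemma integral_mul_secondDeriv_nonpos {e : E} {f g h : ℝ → ℝ}
    (hf : ContinuousOn f (G.closedEdge e)) (hg : ContinuousOn g (G.closedEdge e))
    (hf2 : MemLp f 2 (G.edgeMeasure e)) (hg2 : MemLp g 2 (G.edgeMeasure e))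
    (hh2 : MemLp h 2 (G.edgeMeasure e)) (hfg : G.HasRealWeakDeriv e f g)
    (hgh : G.HasRealWeakDeriv e g h) (h0 : f 0 = 0)
    (hL : G.length e ≠ ⊤ → f (G.length e).toReal = 0) :
    ∫ x, f x * h x ∂G.edgeMeasure e ≤ 0 := by
  have hgg : Integrable (fun x => g x * g x) (G.edgeMeasure e) := hg2.integrable_mul hg2
  have hfh : Integrable (fun x => f x * h x) (G.edgeMeasure e) := hf2.integrable_mul hh2
  have hnn : 0 ≤ ∫ x, g x * g x ∂G.edgeMeasure e := integral_nonneg fun x => mul_self_nonneg _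
  have hii : ∀ k : ℝ → ℝ, MemLp k 2 (G.edgeMeasure e) → ∀ b : ℝ, 0 < b → Ioo 0 b ⊆ G.openEdge e →
      IntervalIntegrable k volume 0 b := by
    intro k hk b hb ho
    rw [intervalIntegrable_iff_integrableOn_Ioo_of_le hb.le]
    have : MemLp k 2 (volume.restrict (Ioo 0 b)) := hk.mono_measure (Measure.restrict_mono ho le_rfl)
    exact this.integrable (by norm_num)
  have hparts : ∀ b : ℝ, 0 < b → Ioo 0 b ⊆ G.openEdge e → Icc 0 b ⊆ G.closedEdge e →
      f b * g b = ∫ x in 0..b, (g x * g x + f x * h x) := by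
    intro b hb ho hc
    have := mul_sub_mul_eq_integral hb (hii g hg2 b hb ho) (hii h hh2 b hb ho)
      (hfg.eq_add_integral hb ho (hf.mono hc) (hii g hg2 b hb ho))
      (hgh.eq_add_integral hb ho (hg.mono hc) (hii h hh2 b hb ho))
    rwa [h0, zero_mul, sub_zero] at this
  -- The integrand is the derivative of `f g`, so a vanishing total gives `∫ f h = -∫ g²`.
  suffices hsum : ∫ x, (g x * g x + f x * h x) ∂G.edgeMeasure e = 0 by
    rw [integral_add hgg hfh] at hsum
    linarith
  by_cases htop : G.length e = ⊤
  · have hfgi := hf2.integrable_mul hg2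
    rw [edgeMeasure, openEdge_of_eq_top htop] at hgg hfh hfgi ⊢
    have hlim := intervalIntegral_tendsto_integral_Ioi 0 (hgg.add hfh) tendsto_id
    have hlim' : Tendsto (f * g) atTop
        (𝓝 (∫ x in Ioi 0, (g x * g x + f x * h x))) := by
      refine hlim.congr' ?_
      filter_upwards [eventually_gt_atTop 0] with b hb
      exact (hparts b hb (by rw [openEdge_of_eq_top htop]; exact Ioo_subset_Ioi_self)
        (by rw [closedEdge_of_eq_top htop]; exact Icc_subset_Ici_self)).symm
    -- On a half-line `f g` is integrable and has a limit at infinity, which must therefore be zero.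
    refine IntegrableAtFilter.eq_zero_of_tendsto (μ := volume) (f := f * g) (l := atTop)
      ⟨Ioi 0, Ioi_mem_atTop 0, hfgi⟩ ?_ hlim'
    intro s hs
    obtain ⟨a, ha⟩ := mem_atTop_sets.mp hs
    exact measure_mono_top (show Ici a ⊆ s from ha) Real.volume_Ici
  · have := hparts _ (length_toReal_pos htop) (openEdge_of_ne_top htop).ge
      (closedEdge_of_ne_top htop).ge
    rw [hL htop, zero_mul, intervalIntegral.integral_of_le (length_toReal_pos htop).le,
      integral_Ioc_eq_integral_Ioo] at this
    rw [edgeMeasure, openEdge_of_ne_top htop]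
    exact this.symm

/-- Continuous real-linear functionals commute with the integral. Taking `ℓ` to be the real or
imaginary part reduces complex functions to real ones. -/
lemma HasEdgeWeakDeriv.congr_real {e : E} {f g : G.EdgeL2 e} (h : G.HasEdgeWeakDeriv e f g)
    (ℓ : ℂ →L[ℝ] ℝ) {F F' : ℝ → ℝ} (hF : F =ᵐ[G.edgeMeasure e] fun x => ℓ (f x))
    (hF' : F' =ᵐ[G.edgeMeasure e] fun x => ℓ (g x)) : G.HasRealWeakDeriv e F F' := by
  have key : ∀ (θ : ℝ → ℝ) (u : G.EdgeL2 e) (U : ℝ → ℝ), Continuous θ → HasCompactSupport θ →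
      U =ᵐ[G.edgeMeasure e] (fun x => ℓ (u x)) →
      ∫ x, θ x * U x ∂G.edgeMeasure e = ℓ (∫ x, θ x • u x ∂G.edgeMeasure e) := by
    intro θ u U hθ hc hU
    rw [← ℓ.integral_comp_comm (integrable_smul_edge u hθ hc)]
    refine integral_congr_ae ?_
    filter_upwards [hU] with x hx
    rw [hx, map_smul, smul_eq_mul]
  intro φ hφ hc hs
  rw [key _ f F (hφ.continuous_deriv (by simp)) hc.deriv hF, key _ g F' hφ.continuous hc hF',
    h φ hφ hc hs, map_neg]

/-- The real part of the inner product is `∫ Re f Re h + ∫ Im f Im h`, and the real case applies to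
each summand. -/
lemma re_inner_secondDeriv_nonpos {e : E} {f g h : G.EdgeL2 e} (hfg : G.HasEdgeWeakDeriv e f g)
    (hgh : G.HasEdgeWeakDeriv e g h) {F F' : ℝ → ℂ} (hF : ContinuousOn F (G.closedEdge e))
    (hF' : ContinuousOn F' (G.closedEdge e)) (hfF : f =ᵐ[G.edgeMeasure e] F)
    (hgF' : g =ᵐ[G.edgeMeasure e] F') (h0 : F 0 = 0)
    (hL : G.length e ≠ ⊤ → F (G.length e).toReal = 0) : (inner ℂ f h).re ≤ 0 := by
  have mem : ∀ (ℓ : ℂ →L[ℝ] ℝ) (u : G.EdgeL2 e), MemLp (fun x => ℓ (u x)) 2 (G.edgeMeasure e) :=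
    fun ℓ u => (Lp.memLp u).continuousLinearMap_comp ℓ
  have part : ∀ ℓ : ℂ →L[ℝ] ℝ, ∫ x, ℓ (f x) * ℓ (h x) ∂G.edgeMeasure e ≤ 0 := by
    intro ℓ
    have e1 : (fun x => ℓ (F x)) =ᵐ[G.edgeMeasure e] fun x => ℓ (f x) := by
      filter_upwards [hfF] with x hx; rw [hx]
    have e2 : (fun x => ℓ (F' x)) =ᵐ[G.edgeMeasure e] fun x => ℓ (g x) := by
      filter_upwards [hgF'] with x hx; rw [hx]
    have := integral_mul_secondDeriv_nonpos (ℓ.continuous.comp_continuousOn hF)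
      (ℓ.continuous.comp_continuousOn hF') ((mem ℓ f).ae_eq e1.symm) ((mem ℓ g).ae_eq e2.symm)
      (mem ℓ h) (hfg.congr_real ℓ e1 e2) (hgh.congr_real ℓ e2 Filter.EventuallyEq.rfl)
      (by simp [h0]) (fun hne => by simp [hL hne])
    refine le_of_eq_of_le (integral_congr_ae ?_) this
    filter_upwards [hfF] with x hx
    simp [hx]
  have hre : (inner ℂ f h).re = ∫ x, Complex.reCLM (f x) * Complex.reCLM (h x) ∂G.edgeMeasure e +
      ∫ x, Complex.imCLM (f x) * Complex.imCLM (h x) ∂G.edgeMeasure e := by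
    refine Eq.trans ?_ (integral_add ((mem Complex.reCLM f).integrable_mul (mem Complex.reCLM h))
      ((mem Complex.imCLM f).integrable_mul (mem Complex.imCLM h)))
    rw [L2.inner_def, ← Complex.reCLM_apply, ← Complex.reCLM.integral_comp_comm (L2.integrable_inner f h)]
    refine integral_congr_ae (Filter.Eventually.of_forall fun x => ?_)
    simp [mul_comm]
  rw [hre]
  exact add_nonpos (part _) (part _)

end Edge

/-! ### Boundary values and the inclusion in the half-line -/

section Trace

variable [Fintype E] {A B : ∀ v, Matrix (G.EndsAt v) (G.EndsAt v) ℂ}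

lemma exists_isContinuousRep (ψ : G.hamiltonianDomain A B) :
    ∃ F, G.IsContinuousRep (ψ : G.L2) F := by
  obtain ⟨-, -, -, -, F, -, hF, -⟩ := ψ.2
  exact ⟨F, hF⟩

variable (G A B) in
/-- The values at the ends of the edges of a function in the domain of the Hamiltonian. -/
noncomputable def endValues : G.hamiltonianDomain A B →ₗ[ℂ] (G.EdgeEnd → ℂ) where
  -- The choice is harmless: continuous representatives agree on the closed edge, which contains the
  -- ends. Linearity rests on the same uniqueness.
  toFun ψ a := (exists_isContinuousRep ψ).choose (G.endEdge a) (G.endCoord a)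
  map_add' ψ φ := by
    ext a
    exact (exists_isContinuousRep (ψ + φ)).choose_spec.eqOn
      ((exists_isContinuousRep ψ).choose_spec.add (exists_isContinuousRep φ).choose_spec)
      _ (endCoord_mem_closedEdge a)
  map_smul' c ψ := by
    ext a
    exact (exists_isContinuousRep (c • ψ)).choose_spec.eqOn
      ((exists_isContinuousRep ψ).choose_spec.smul c) _ (endCoord_mem_closedEdge a)

lemma endValues_apply {ψ : G.hamiltonianDomain A B} {F : E → ℝ → ℂ}
    (hF : G.IsContinuousRep (ψ : G.L2) F) (a : G.EdgeEnd) :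
    endValues G A B ψ a = F (G.endEdge a) (G.endCoord a) :=
  (exists_isContinuousRep ψ).choose_spec.eqOn hF _ (endCoord_mem_closedEdge a)

/-- The Hamiltonian is nonnegative on the functions which vanish at the vertices. -/
lemma re_inner_hamiltonian_nonneg {ψ : (G.hamiltonian A B).domain}
    (h : endValues G A B ψ = 0) : 0 ≤ (inner ℂ (ψ : G.L2) (G.hamiltonian A B ψ)).re := by
  obtain ⟨ψ₁, ψ₂, h₁, h₂, F, F', hF, hF', -⟩ := ψ.2
  rw [hamiltonian_apply h₁ h₂, inner_neg_right, Complex.neg_re, PiLp.inner_apply, Complex.re_sum]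
  refine neg_nonneg.mpr (Finset.sum_nonpos fun e _ => ?_)
  refine re_inner_secondDeriv_nonpos (h₁ e) (h₂ e) (hF e).1 (hF' e).1 (hF e).2 (hF' e).2 ?_ ?_
  · have := endValues_apply (A := A) (B := B) (ψ := ψ) hF (Sum.inl e)
    rw [h] at this
    exact this.symm
  · intro hne
    have := endValues_apply (A := A) (B := B) (ψ := ψ) hF (Sum.inr ⟨e, hne⟩)
    rw [h] at this
    exact this.symm

/-- By nonnegativity `Re ⟨ψ, (H - t)ψ⟩ ≥ -t ‖ψ‖²`, and Cauchy–Schwarz bounds the left side. This is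
informative for `t < 0`. -/
lemma norm_hamiltonian_sub_ge {t : ℝ} {ψ : (G.hamiltonian A B).domain}
    (h : endValues G A B ψ = 0) :
    -t * ‖(ψ : G.L2)‖ ≤ ‖G.hamiltonian A B ψ - (t : ℂ) • (ψ : G.L2)‖ := by
  have h1 := re_inner_hamiltonian_nonneg h
  have h2 : (inner ℂ (ψ : G.L2) (G.hamiltonian A B ψ - (t : ℂ) • (ψ : G.L2))).re =
      (inner ℂ (ψ : G.L2) (G.hamiltonian A B ψ)).re - t * ‖(ψ : G.L2)‖ ^ 2 := by
    rw [inner_sub_right, inner_smul_right, inner_self_eq_norm_sq_to_K, ← RCLike.ofReal_pow,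
      RCLike.ofReal_eq_complex_ofReal, Complex.sub_re, ← Complex.ofReal_mul, Complex.ofReal_re]
  have h3 := (Complex.re_le_norm _).trans
    (norm_inner_le_norm (𝕜 := ℂ) (ψ : G.L2) (G.hamiltonian A B ψ - (t : ℂ) • (ψ : G.L2)))
  rcases eq_or_lt_of_le (norm_nonneg (ψ : G.L2)) with h0 | h0
  · rw [← h0, mul_zero]; exact norm_nonneg _
  · nlinarith

/-- The essential spectrum of a self-adjoint Hamiltonian is contained in `[0, ∞)`. -/
lemma essentialSpectrum_subset (hH : IsSelfAdjoint (G.hamiltonian A B)) :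
    UnboundedOperator.essentialSpectrum (G.hamiltonian A B) ⊆
      (fun t : ℝ => (t : ℂ)) '' Set.Ici (0 : ℝ) := by
  rintro z ⟨hz, hz'⟩
  have him : z.im = 0 := by
    by_contra him
    exact hz (UnboundedOperator.mem_resolventSet_of_im_ne_zero hH him)
  obtain ⟨t, rfl⟩ : ∃ t : ℝ, (t : ℂ) = z := ⟨z.re, Complex.ext rfl (by simp [him])⟩
  refine ⟨t, ?_, rfl⟩
  by_contra ht
  have ht : 0 < -t := by simpa using ht
  -- The values at the ends form a finite-dimensional space, so their vanishing is a condition of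
  -- finite codimension.
  exact hz' (UnboundedOperator.mem_discreteSpectrum_of_bound hH ht (endValues G A B)
    (fun ψ h => norm_hamiltonian_sub_ge h) hz)

end Trace

end MetricGraph

/-! ### Test functions supported on one edge -/

namespace MetricGraph

variable {V E : Type*} {G : MetricGraph V E}

section TestFunctions

open Set

lemma memLp_edge (e : E) {w : ℝ → ℂ} (hw : Continuous w) (hc : HasCompactSupport w) :
    MemLp w 2 (G.edgeMeasure e) :=
  (hw.memLp_of_hasCompactSupport (μ := volume) hc).mono_measure Measure.restrict_le_self

open Classical in
/-- The element of `L²(G)` given by a test function `w` on the edge `e`, extended by zero. -/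
noncomputable def ofEdge (G : MetricGraph V E) (e : E) {w : ℝ → ℂ} (hw : Continuous w)
    (hc : HasCompactSupport w) : G.L2 :=
  PiLp.single 2 e ((memLp_edge e hw hc).toLp w)

open Classical in
lemma ofEdge_ae_eq (e : E) {w : ℝ → ℂ} (hw : Continuous w) (hc : HasCompactSupport w) (e' : E) :
    G.ofEdge e hw hc e' =ᵐ[G.edgeMeasure e'] (Pi.single e w : E → ℝ → ℂ) e' := by
  by_cases h : e' = e
  · subst h
    rw [ofEdge, PiLp.single_eq_same, Pi.single_eq_same]
    exact MemLp.coeFn_toLp _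
  · rw [ofEdge, PiLp.single_eq_of_ne _ h, Pi.single_eq_of_ne h]
    exact Lp.coeFn_zero _ _ _

open Classical in
lemma isContinuousRep_ofEdge (e : E) {w : ℝ → ℂ} (hw : Continuous w) (hc : HasCompactSupport w) :
    G.IsContinuousRep (G.ofEdge e hw hc) (Pi.single e w) := by
  refine fun e' => ⟨?_, ofEdge_ae_eq e hw hc e'⟩
  by_cases h : e' = e
  · subst h; rw [Pi.single_eq_same]; exact hw.continuousOn
  · rw [Pi.single_eq_of_ne h]; exact continuousOn_const

lemma setIntegral_smul_eq_integral_of_tsupport {s : Set ℝ} {φ : ℝ → ℝ} (f : ℝ → ℂ)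
    (hφ : tsupport φ ⊆ s) : ∫ x in s, φ x • f x = ∫ x, φ x • f x :=
  setIntegral_eq_integral_of_forall_compl_eq_zero fun x hx => by
    rw [image_eq_zero_of_notMem_tsupport fun h => hx (hφ h), zero_smul]

/-- Since `φ` is supported in the open edge, the integrals extend to the whole line and no boundary
terms arise, whatever `w` does at the endpoints. -/
lemma hasWeakDeriv_ofEdge (e : E) {w : ℝ → ℂ} (hw : ContDiff ℝ ∞ w) (hc : HasCompactSupport w) :
    G.HasWeakDeriv (G.ofEdge e hw.continuous hc)
      (G.ofEdge e (hw.continuous_deriv (by simp)) hc.deriv) := by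
  classical
  intro e' φ hφ hφc hφs
  have hd : Continuous (deriv φ) := hφ.continuous_deriv (by simp)
  have hwd : Continuous (deriv w) := hw.continuous_deriv (by simp)
  have key : ∀ (θ : ℝ → ℝ) {u : ℝ → ℂ} (hu : Continuous u) (huc : HasCompactSupport u),
      tsupport θ ⊆ G.openEdge e' → ∫ x, θ x • G.ofEdge e hu huc e' x ∂G.edgeMeasure e' =
        ∫ x, θ x • (Pi.single e u : E → ℝ → ℂ) e' x := by
    intro θ u hu huc hθ
    rw [← setIntegral_smul_eq_integral_of_tsupport _ hθ]
    refine integral_congr_ae ?_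
    filter_upwards [ofEdge_ae_eq (G := G) e hu huc e'] with x hx
    rw [hx]
  rw [key _ _ _ (tsupport_deriv_subset.trans hφs), key _ _ _ hφs]
  by_cases h : e' = e
  · subst h
    rw [Pi.single_eq_same, Pi.single_eq_same, eq_comm, neg_eq_iff_eq_neg]
    refine integral_bilinear_hasDerivAt_right_eq_neg_left_of_integrable
      (L := ContinuousLinearMap.lsmul ℝ ℝ)
      (fun x _ => (hφ.differentiable (by simp) x).hasDerivAt)
      (fun x _ => (hw.differentiable (by simp) x).hasDerivAt) ?_ ?_ ?_
    · exact (hφ.continuous.smul hwd).integrable_of_hasCompactSupport hφc.smul_right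
    · exact (hd.smul hw.continuous).integrable_of_hasCompactSupport hφc.deriv.smul_right
    · exact (hφ.continuous.smul hw.continuous).integrable_of_hasCompactSupport hφc.smul_right
  · simp [Pi.single_eq_of_ne h]

lemma endCoord_notMem_openEdge (a : G.EdgeEnd) : G.endCoord a ∉ G.openEdge (G.endEdge a) := by
  rcases a with e | e
  · exact fun h => lt_irrefl _ h.1
  · intro h
    have := h.2
    simp [endCoord, endEdge, ENNReal.ofReal_toReal e.2] at this

lemma single_endCoord_eq_zero [DecidableEq E] {e : E} {w : ℝ → ℂ} (hs : tsupport w ⊆ G.openEdge e)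
    (a : G.EdgeEnd) : (Pi.single e w : E → ℝ → ℂ) (G.endEdge a) (G.endCoord a) = 0 := by
  by_cases h : G.endEdge a = e
  · rw [h, Pi.single_eq_same]
    refine image_eq_zero_of_notMem_tsupport fun hm => endCoord_notMem_openEdge a ?_
    rw [h]
    exact hs hm
  · rw [Pi.single_eq_of_ne h]; rfl

variable [Fintype E] {A B : ∀ v, Matrix (G.EndsAt v) (G.EndsAt v) ℂ}

lemma norm_sq_ofEdge (e : E) {w : ℝ → ℂ} (hw : Continuous w) (hc : HasCompactSupport w)
    (hs : tsupport w ⊆ G.openEdge e) : ‖G.ofEdge e hw hc‖ ^ 2 = ∫ x, ‖w x‖ ^ 2 := by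
  classical
  have h := (inner_self_eq_norm_sq (𝕜 := ℂ) ((memLp_edge (G := G) e hw hc).toLp w))
  rw [ofEdge, PiLp.norm_single, ← h, L2.inner_def, RCLike.re_eq_complex_re, ← Complex.reCLM_apply,
    ← Complex.reCLM.integral_comp_comm (L2.integrable_inner _ _)]
  refine Eq.trans (integral_congr_ae ?_)
    (setIntegral_eq_integral_of_forall_compl_eq_zero (s := G.openEdge e) fun x hx => by
      rw [image_eq_zero_of_notMem_tsupport fun h => hx (hs h), norm_zero, zero_pow two_ne_zero])
  filter_upwards [MemLp.coeFn_toLp (memLp_edge (G := G) e hw hc)] with x hx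
  rw [hx, inner_self_eq_norm_sq_to_K, ← RCLike.ofReal_pow]
  exact Complex.ofReal_re _

/-- The support avoids the ends of the edge, so all boundary values and derivatives vanish and every
choice of `A`, `B` is satisfied. -/
lemma ofEdge_mem_domain (e : E) {w : ℝ → ℂ} (hw : ContDiff ℝ ∞ w) (hc : HasCompactSupport w)
    (hs : tsupport w ⊆ G.openEdge e) :
    G.ofEdge e hw.continuous hc ∈ (G.hamiltonian A B).domain := by
  classical
  have hw' : ContDiff ℝ ∞ (deriv w) := (contDiff_infty_iff_deriv.mp hw).2
  refine ⟨_, _, hasWeakDeriv_ofEdge e hw hc, hasWeakDeriv_ofEdge e hw' hc.deriv, Pi.single e w,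
    Pi.single e (deriv w), isContinuousRep_ofEdge e _ hc, isContinuousRep_ofEdge e _ hc.deriv,
    fun v => ?_⟩
  have e₁ : G.vertexValues (Pi.single e w) v = 0 := by
    ext a; exact single_endCoord_eq_zero hs a.1
  have e₂ : G.vertexDerivs (Pi.single e (deriv w)) v = 0 := by
    ext a
    rw [vertexDerivs, single_endCoord_eq_zero (tsupport_deriv_subset.trans hs), mul_zero]; rfl
  rw [e₁, e₂, Matrix.mulVec_zero, Matrix.mulVec_zero, add_zero]

/-- At a point `z` of the resolvent set, `H - z` is bounded below on the test functions on an
edge. -/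
lemma exists_integral_le_of_mem_resolventSet {z : ℂ}
    (hz : z ∈ UnboundedOperator.resolventSet (G.hamiltonian A B)) (e : E) :
    ∃ C : ℝ, ∀ w : ℝ → ℂ, ContDiff ℝ ∞ w → HasCompactSupport w → tsupport w ⊆ G.openEdge e →
      ∫ x, ‖w x‖ ^ 2 ≤ C * ∫ x, ‖deriv (deriv w) x + z * w x‖ ^ 2 := by
  classical
  obtain ⟨R, -, hR⟩ := hz
  -- The function `w'' + z w` is `-(H - z)w`, and `R` recovers `w` from `(H - z)w`.
  refine ⟨‖R‖ ^ 2, fun w hw hc hs => ?_⟩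
  have hw' : ContDiff ℝ ∞ (deriv w) := (contDiff_infty_iff_deriv.mp hw).2
  have hw2 : Continuous (deriv (deriv w)) := hw'.continuous_deriv (by simp)
  have hu := hR ⟨_, ofEdge_mem_domain (A := A) (B := B) e hw hc hs⟩
  rw [hamiltonian_apply (hasWeakDeriv_ofEdge e hw hc) (hasWeakDeriv_ofEdge e hw' hc.deriv)] at hu
  have hvc : Continuous (fun x => deriv (deriv w) x + z * w x) :=
    hw2.add (continuous_const.mul hw.continuous)
  have hvs : HasCompactSupport (fun x => deriv (deriv w) x + z * w x) :=
    hc.deriv.deriv.add hc.mul_left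
  have hvt : tsupport (fun x => deriv (deriv w) x + z * w x) ⊆ G.openEdge e := by
    refine Subset.trans (closure_minimal (fun x hx => ?_) isClosed_closure) hs
    by_contra hcon
    refine hx ?_
    have h2 : x ∉ tsupport (deriv (deriv w)) := fun h =>
      hcon (tsupport_deriv_subset (tsupport_deriv_subset h))
    simp only [image_eq_zero_of_notMem_tsupport hcon, image_eq_zero_of_notMem_tsupport h2, mul_zero,
      add_zero]
  have hv : G.ofEdge e hvc hvs = G.ofEdge e hw2 hc.deriv.deriv + z • G.ofEdge e hw.continuous hc := by
    ext1 e'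
    refine Lp.ext ?_
    filter_upwards [ofEdge_ae_eq (G := G) e hvc hvs e', ofEdge_ae_eq (G := G) e hw.continuous hc e',
      ofEdge_ae_eq (G := G) e hw2 hc.deriv.deriv e',
      Lp.coeFn_add (G.ofEdge e hw2 hc.deriv.deriv e') (z • G.ofEdge e hw.continuous hc e'),
      Lp.coeFn_smul z (G.ofEdge e hw.continuous hc e')] with x h1 h2 h3 h4 h5
    rw [PiLp.add_apply, PiLp.smul_apply, h4, Pi.add_apply, h5, Pi.smul_apply, h1, h2, h3]
    by_cases h : e' = e
    · subst h; simp
    · simp [Pi.single_eq_of_ne h]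
  rw [← norm_sq_ofEdge e hw.continuous hc hs, ← norm_sq_ofEdge e hvc hvs hvt, ← mul_pow, hv]
  gcongr
  calc ‖G.ofEdge e hw.continuous hc‖ = ‖R (-G.ofEdge e hw2 hc.deriv.deriv -
        z • G.ofEdge e hw.continuous hc)‖ := by rw [hu]
    _ ≤ _ := R.le_opNorm _
    _ = _ := by rw [← neg_add', norm_neg]

end TestFunctions

/-! ### Weyl sequences on an infinite edge -/

section Weyl

open Set Filter Topology

/-- The second derivative of a rescaled cutoff times a plane wave. -/
lemma deriv_deriv_cutoff_mul_exp {η : ℝ → ℝ} (hη : ContDiff ℝ ∞ η) (ε k : ℝ) (x : ℝ) :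
    deriv (deriv fun y : ℝ => (η (ε * y) : ℂ) * Complex.exp (Complex.I * k * y)) x +
        (k ^ 2 : ℝ) * ((η (ε * x) : ℂ) * Complex.exp (Complex.I * k * x)) =
      ((ε ^ 2 * deriv (deriv η) (ε * x) : ℝ) + (2 * k * ε * deriv η (ε * x) : ℝ) * Complex.I) *
        Complex.exp (Complex.I * k * x) := by
  have hη' : ContDiff ℝ ∞ (deriv η) := (contDiff_infty_iff_deriv.mp hη).2
  have hexp : ∀ y : ℝ, HasDerivAt (fun y : ℝ => Complex.exp (Complex.I * k * y))
      (Complex.exp (Complex.I * k * y) * (Complex.I * k)) y := by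
    intro y
    have := ((Complex.ofRealCLM.hasDerivAt (x := y)).const_mul (Complex.I * k)).cexp
    simpa using this
  have hcut : ∀ θ : ℝ → ℝ, Differentiable ℝ θ → ∀ y : ℝ,
      HasDerivAt (fun y : ℝ => (θ (ε * y) : ℂ)) ((ε * deriv θ (ε * y) : ℝ) : ℂ) y := by
    intro θ hθ y
    have h1 : HasDerivAt (fun y : ℝ => ε * y) ε y := by
      simpa using (hasDerivAt_id y).const_mul ε
    have := (hθ (ε * y)).hasDerivAt.comp y h1
    rw [mul_comm] at this
    exact this.ofReal_comp
  have h1 : ∀ y : ℝ, HasDerivAt (fun y : ℝ => (η (ε * y) : ℂ) * Complex.exp (Complex.I * k * y))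
      (((ε * deriv η (ε * y) : ℝ) : ℂ) * Complex.exp (Complex.I * k * y) +
        (η (ε * y) : ℂ) * (Complex.exp (Complex.I * k * y) * (Complex.I * k))) y := fun y =>
    (hcut η (hη.differentiable (by simp)) y).mul (hexp y)
  have h2 := (((hcut (deriv η) (hη'.differentiable (by simp)) x).const_mul (ε : ℂ)).mul
    (hexp x)).add ((hcut η (hη.differentiable (by simp)) x).mul
      ((hexp x).mul_const (Complex.I * k)))
  have h3 : deriv (fun y : ℝ => (η (ε * y) : ℂ) * Complex.exp (Complex.I * k * y)) =
      ((fun y : ℝ => (ε : ℂ) * ((deriv η (ε * y) : ℝ) : ℂ)) * fun y : ℝ => Complex.exp (Complex.I * k * y)) +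
        ((fun y : ℝ => (η (ε * y) : ℂ)) *
          fun y : ℝ => Complex.exp (Complex.I * k * y) * (Complex.I * k)) := by
    ext y
    rw [(h1 y).deriv]
    simp
  rw [h3, h2.deriv]
  push_cast
  linear_combination (η (ε * x) * Complex.exp (Complex.I * k * x) * k ^ 2) * Complex.I_sq

lemma norm_real_add_mul_I_sq (a b : ℝ) : ‖(a : ℂ) + (b : ℂ) * Complex.I‖ ^ 2 = a ^ 2 + b ^ 2 := by
  rw [Complex.sq_norm, Complex.normSq_add_mul_I]

/-- The half-line is invariant under positive dilations, so every rescaling of this cutoff still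
lives on it. -/
lemma exists_bump_Ioi : ∃ η : ℝ → ℝ, ContDiff ℝ ∞ η ∧ HasCompactSupport η ∧
    tsupport η ⊆ Ioi 0 ∧ η 2 ≠ 0 := by
  let B : ContDiffBump (2 : ℝ) := ⟨1 / 2, 1, by norm_num, by norm_num⟩
  have hB : B 2 ≠ 0 := (B.pos_of_mem_ball (Metric.mem_ball_self B.rOut_pos)).ne'
  refine ⟨B, B.contDiff, B.hasCompactSupport, ?_, hB⟩
  rw [B.tsupport_eq, Real.closedBall_eq_Icc]
  intro x hx
  have : (2 : ℝ) - 1 ≤ x := hx.1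
  exact lt_of_lt_of_le (by norm_num) this

/-- There is no lower bound for `d²/dx² + k²` on the test functions on a half-line. -/
lemma not_exists_integral_le (k : ℝ) : ¬ ∃ C : ℝ, ∀ w : ℝ → ℂ, ContDiff ℝ ∞ w →
    HasCompactSupport w → tsupport w ⊆ Ioi 0 →
      ∫ x, ‖w x‖ ^ 2 ≤ C * ∫ x, ‖deriv (deriv w) x + (k ^ 2 : ℝ) * w x‖ ^ 2 := by
  rintro ⟨C, hC⟩
  obtain ⟨η, hη, hηc, hηs, hη2⟩ := exists_bump_Ioi
  have hη' : ContDiff ℝ ∞ (deriv η) := (contDiff_infty_iff_deriv.mp hη).2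
  have c0 := hη.continuous
  have c1 := hη'.continuous
  have c2 : Continuous (deriv (deriv η)) := hη'.continuous_deriv (by simp)
  have hsqc : ∀ {θ : ℝ → ℝ}, HasCompactSupport θ → HasCompactSupport fun x => θ x ^ 2 := by
    intro θ hc
    simp only [sq]
    exact hc.mul_left
  have hsq : ∀ {θ : ℝ → ℝ}, Continuous θ → HasCompactSupport θ → Integrable fun x => θ x ^ 2 := by
    intro θ hθ hc
    exact (hθ.pow 2).integrable_of_hasCompactSupport (hsqc hc)
  have hpos : 0 < ∫ x, η x ^ 2 :=
    (c0.pow 2).integral_pos_of_hasCompactSupport_nonneg_nonzero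
      (hsqc hηc) (fun x => sq_nonneg _) (x := 2)
      (pow_ne_zero 2 hη2)
  -- This is the assumed bound for `η(εy) exp(iky)`: the terms `k² w` cancel, so each remaining term
  -- carries a derivative of the cutoff and hence a factor `ε`.
  have hbound : ∀ ε : ℝ, 0 < ε → ∫ x, η x ^ 2 ≤
      C * (ε ^ 4 * (∫ x, deriv (deriv η) x ^ 2) + 4 * k ^ 2 * ε ^ 2 * ∫ x, deriv η x ^ 2) := by
    intro ε hε
    have hexp : ContDiff ℝ ∞ fun y : ℝ => Complex.exp (Complex.I * k * y) :=
      (contDiff_const.mul Complex.ofRealCLM.contDiff).cexp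
    have hcut : ContDiff ℝ ∞ fun y : ℝ => (η (ε * y) : ℂ) :=
      Complex.ofRealCLM.contDiff.comp (hη.comp (contDiff_const.mul contDiff_id))
    have hzero : ∀ y, y ∉ (fun y : ℝ => ε * y) ⁻¹' tsupport η →
        (η (ε * y) : ℂ) * Complex.exp (Complex.I * k * y) = 0 := fun y hy => by
      rw [image_eq_zero_of_notMem_tsupport hy, Complex.ofReal_zero, zero_mul]
    have hcomp : IsCompact ((fun y : ℝ => ε * y) ⁻¹' tsupport η) :=
      (Homeomorph.mulLeft₀ ε hε.ne').isCompact_preimage.mpr hηc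
    have hw := hC (fun y : ℝ => (η (ε * y) : ℂ) * Complex.exp (Complex.I * k * y))
      (hcut.mul hexp) (HasCompactSupport.intro hcomp hzero) (by
        refine Subset.trans (closure_minimal (t := (fun y : ℝ => ε * y) ⁻¹' tsupport η)
          (fun y hy => ?_) hcomp.isClosed) fun y hy => ?_
        · by_contra h
          exact hy (hzero y h)
        · exact (mul_pos_iff_of_pos_left hε).mp (hηs hy))
    have hne : ∀ x : ℝ, ‖Complex.exp (Complex.I * k * x)‖ = 1 := fun x => by
      rw [show Complex.I * (k : ℂ) * x = ((k * x : ℝ) : ℂ) * Complex.I by push_cast; ring,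
        Complex.norm_exp_ofReal_mul_I]
    simp only [deriv_deriv_cutoff_mul_exp hη, norm_mul, hne, mul_one, norm_real_add_mul_I_sq,
      Complex.norm_real, Real.norm_eq_abs, sq_abs] at hw
    rw [Measure.integral_comp_mul_left (fun x => η x ^ 2) ε,
      Measure.integral_comp_mul_left (fun x => (ε ^ 2 * deriv (deriv η) x) ^ 2 +
        (2 * k * ε * deriv η x) ^ 2) ε, smul_eq_mul, smul_eq_mul] at hw
    -- The change of variables puts the same factor `|ε⁻¹|` on both sides. Cancelling it leaves a
    -- left side independent of `ε`, while the right side tends to zero.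
    have hε' : 0 < |ε⁻¹| := abs_pos.mpr (inv_pos.mpr hε).ne'
    rw [mul_left_comm, mul_le_mul_iff_right₀ hε'] at hw
    refine hw.trans (le_of_eq ?_)
    simp_rw [mul_pow]
    rw [integral_add ((hsq c2 hηc.deriv.deriv).const_mul _) ((hsq c1 hηc.deriv).const_mul _),
      integral_const_mul, integral_const_mul]
    ring
  have hlim : Tendsto (fun ε : ℝ => C * (ε ^ 4 * (∫ x, deriv (deriv η) x ^ 2) +
      4 * k ^ 2 * ε ^ 2 * ∫ x, deriv η x ^ 2)) (𝓝[>] 0) (𝓝 0) := by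
    have : Continuous (fun ε : ℝ => C * (ε ^ 4 * (∫ x, deriv (deriv η) x ^ 2) +
      4 * k ^ 2 * ε ^ 2 * ∫ x, deriv η x ^ 2)) := by fun_prop
    have h0 := this.tendsto 0
    simp only [ne_eq, OfNat.ofNat_ne_zero, not_false_eq_true, zero_pow, zero_mul, mul_zero,
      add_zero] at h0
    exact h0.mono_left nhdsWithin_le_nhds
  have := ge_of_tendsto hlim (eventually_nhdsWithin_of_forall hbound)
  linarith

variable [Fintype E] {A B : ∀ v, Matrix (G.EndsAt v) (G.EndsAt v) ℂ}

lemma mem_spectrum_of_nonneg {e : E} (he : G.length e = ⊤) {t : ℝ} (ht : 0 ≤ t) :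
    (t : ℂ) ∈ UnboundedOperator.spectrum (G.hamiltonian A B) := by
  intro hres
  obtain ⟨C, hC⟩ := exists_integral_le_of_mem_resolventSet hres e
  refine not_exists_integral_le (Real.sqrt t) ⟨C, fun w hw hc hs => ?_⟩
  rw [Real.sq_sqrt ht]
  exact hC w hw hc (by rwa [openEdge_of_eq_top he])

lemma subset_essentialSpectrum {e : E} (he : G.length e = ⊤) :
    (fun t : ℝ => (t : ℂ)) '' Ici (0 : ℝ) ⊆
      UnboundedOperator.essentialSpectrum (G.hamiltonian A B) := by
  rintro _ ⟨t, ht, rfl⟩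
  refine ⟨mem_spectrum_of_nonneg he ht, fun hdisc => ?_⟩
  obtain ⟨-, ⟨ε, hε, hiso⟩, -⟩ := hdisc
  have ht : 0 ≤ t := ht
  -- The point `t + ε / 2` is also spectrum and lies within the radius of isolation `ε` of `t`.
  have h := hiso ((t + ε / 2 : ℝ) : ℂ) (mem_spectrum_of_nonneg he (by positivity)) (by
    rw [Complex.dist_eq, ← Complex.ofReal_sub, Complex.norm_real, Real.norm_eq_abs,
      add_sub_cancel_left, abs_of_pos (by positivity)]
    linarith)
  have := Complex.ofReal_injective h
  linarith

end Weyl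

end MetricGraph

theorem mainTheorem8 {V E : Type*} [Finite V] [Fintype E] (G : MetricGraph V E)
    (hG : ∃ e : E, G.length e = ⊤)
    (A B : ∀ v : V, Matrix (G.EndsAt v) (G.EndsAt v) ℂ)
    (hH : IsSelfAdjoint (G.hamiltonian A B)) :
    UnboundedOperator.essentialSpectrum (G.hamiltonian A B) =
      (fun t : ℝ => (t : ℂ)) '' Set.Ici (0 : ℝ) := by
  obtain ⟨e, he⟩ := hG
  exact (MetricGraph.essentialSpectrum_subset hH).antisymm
    (MetricGraph.subset_essentialSpectrum he)
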